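/- A *region* is a finite union of unit triangles of the triangular lattice with horizontal lattice lines; a *lozenge* is the union of two unit triangles sharing an edge; a *lozenge tiling* of a region is a covering of it by lozenges, contained in it, without gaps or overlaps (the empty region has exactly one tiling). $\operatorname{M}(\mathcal{S})$ denotes the number of lozenge tilings of $\mathcal{S}$. For a finite sequence $\mathbf{a}=(a_1,\dots,a_n)$ put $\operatorname{O}(\mathbf a)=\sum_{i\text{ odd}}a_i$, $\operatorname{E}(\mathbf a)=\sum_{i\text{ even}}a_i$, $\mathbf{s}_n(\mathbf a)=\sum_{i=1}^n a_i$, and $a_k:=0$ for $k>n$. Let $(x)_m=x(x+1)\cdots(x+m-1)$, $\operatorname{H}(m)=0!\,1!\cdots(m-1)!$, and $\operatorname{H}_2(m)=0!\,2!\,4!\cdots(m-2)!$ for even $m$, $\operatorname{H}_2(m)=1!\,3!\,5!\cdots(m-2)!$ for odd $m$; empty products are $1$. *Quartered hexagons.* Let $\mathbf t=(t_1,\dots,t_{2l})$ be non-negative integers. Consider the trapezoidal region whose northern, northeastern and southern sides have lengths $\operatorname{O}(\mathbf t)$, $2\operatorname{E}(\mathbf t)$, $\operatorname{E}(\mathbf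 t)+\operatorname{O}(\mathbf t)$, and whose western side is a vertical zigzag lattice path which, starting from the northwestern corner, goes alternately one unit down-left and one unit down-right. Remove from its base up-pointing triangles of side-lengths $t_2,t_4,\dots,t_{2l}$, from left to right, the first at distance $t_1$ from the left end of the base, the distances between consecutive ones being $t_3,t_5,\dots,t_{2l-1}$. $\operatorname{Q}(\mathbf t)$ is the number of lozenge tilings of the resulting region. $\operatorname{K}(\mathbf t)$ is the number of lozenge tilings of the region obtained in the same way from the trapezoid whose northeastern side has length $2\operatorname{E}(\mathbf t)-1$ instead (the other lengths being the same). If $\operatorname{E}(\mathbf t)=0$ (in particular if $\mathbf t$ is empty), these regions are empty and $\operatorname{Q}(\mathbf t)=\operatorname{K}(\mathbf t)=1$. *The region $\mathcal{R}_{x,y,z}(\mathbf a)$.* Let $x,y,z$ be non-negative integers and $\mathbf a=(a_1,\dots,a_n)$ a (possibly empty) sequence of positive integers. Consider the halved hexagon whose northern, northeastern, southeastern and southern sides have lengths $x+\operatorname{E}(\mathbf a)$, $y+z+2\operatorname{O}(\mathbf a)-1$, $y+z+2\operatorname{E}(\mathbf a)-1$, $x+\operatorname{O}(\mathbf a)$,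 and whose western side is a vertical zigzag lattice path with $y+z+\mathbf s_n(\mathbf a)-1$ steps, each step consisting (from top to bottom) of a unit down-left and a unit down-right. On the horizontal lattice line that meets the northeastern side at distance $z$ from the rightmost vertex, starting at that meeting point and going from right to left, place adjacent triangles of side-lengths $a_1,a_2,\dots,a_n$, each having a side on that line, the triangles of odd index pointing up and those of even index pointing down. Removing these triangles from the halved hexagon gives $\mathcal{R}_{x,y,z}(\mathbf a)$. (In the degenerate case $y=z=0$, $n=1$, where the southeastern length would be $-1$, the region is the part of the trapezoid with northern side $x$, northeastern side $2a_1-1$ and the above zigzag western side that lies in the top $2a_1-2$ horizontal strips, minus the triangle.) **Theorem.** Let $x,y,z$ be non-negative integers and $\mathbf a=(a_1,\dots,a_n)$ a sequence of positive integers such that $y+2\operatorname{O}(\mathbf a)\ge a_1+1$ (for $n=0$ this reads $y\geq 1$). If $y$ is odd, then $$\begin{aligned}\operatorname{M}(\mathcal{R}_{x,y,z}(\mathbf a))={}&\frac{1}{2^{y-1}}\prod_{i=1}^{\frac{y-1}{2}}(2x+2i)_{2\mathbf{s}_n(\mathbf a)+2y+2z-4i+1}\\ &\times\frac{\operatorname{H}(\mathbf{s}_n(\mathbf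 a)+y+z-1)\operatorname{H}_2(y)\operatorname{H}_2(2\operatorname{E}(\mathbf a)+2z+1)\operatorname{H}_2(2\operatorname{O}(\mathbf a)+1)\operatorname{H}_2(2\mathbf{s}_n(\mathbf a)+y+2z)}{\operatorname{H}(\mathbf{s}_n(\mathbf a)+z)\operatorname{H}_2(2\operatorname{E}(\mathbf a)+y+2z)\operatorname{H}_2(2\operatorname{O}(\mathbf a)+y)\operatorname{H}_2(2\mathbf{s}_n(\mathbf a)+2y+2z-1)}\\ &\times\operatorname{Q}\Big(x+\tfrac{y-1}{2}+a_{2\lfloor\frac{n+1}{2}\rfloor},a_{2\lfloor\frac{n+1}{2}\rfloor-1},\dots,a_1\Big)\operatorname{Q}\Big(x+\tfrac{y-1}{2}+a_{2\lfloor\frac{n}{2}\rfloor+1},a_{2\lfloor\frac n2\rfloor},\dots,a_1,z\Big),\end{aligned}$$ and if $y$ is even, then $$\begin{aligned}\operatorname{M}(\mathcal{R}_{x,y,z}(\mathbf a))={}&\prod_{i=1}^{\frac{y}{2}}(2x+2i)_{2\mathbf{s}_n(\mathbf a)+2y+2z-4i+1}\\ &\times\frac{\operatorname{H}(\mathbf{s}_n(\mathbf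 a)+y+z)\operatorname{H}_2(y)\operatorname{H}_2(2\operatorname{E}(\mathbf a)+2z)\operatorname{H}_2(2\operatorname{O}(\mathbf a))\operatorname{H}_2(2\mathbf{s}_n(\mathbf a)+y+2z)}{\operatorname{H}(\mathbf{s}_n(\mathbf a)+z)\operatorname{H}_2(2\operatorname{E}(\mathbf a)+y+2z)\operatorname{H}_2(2\operatorname{O}(\mathbf a)+y)\operatorname{H}_2(2\mathbf{s}_n(\mathbf a)+2y+2z)}\\ &\times\operatorname{K}\Big(x+\tfrac{y}{2}+a_{2\lfloor\frac{n+1}{2}\rfloor},a_{2\lfloor\frac{n+1}{2}\rfloor-1},\dots,a_1\Big)\operatorname{K}\Big(x+\tfrac{y}{2}+a_{2\lfloor\frac{n}{2}\rfloor+1},a_{2\lfloor\frac n2\rfloor},\dots,a_1,z\Big).\end{aligned}$$ For $n=0$ the first $\operatorname{Q}$ (respectively $\operatorname{K}$) factor is that of the empty sequence, i.e. $1$. -/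

import Mathlib

namespace HalvedHexagon

/-!
### The triangular lattice

The lattice has horizontal lattice lines, numbered by their depth `d : ℤ` (depth increases
downwards); abscissas are measured in half unit lengths, so that the lattice points at depth `d`
are the points of abscissa `v` with `v + d` even.

A unit triangle is encoded by a pair `(u, d)`: it lies in the strip between the lattice lines of
depths `d` and `d + 1`, and `u` is the abscissa of its vertical symmetry axis.
* If `u + d` is even, it is up-pointing, with vertices `u` (at depth `d`) and `u - 1`, `u + 1`
  (at depth `d + 1`).
* If `u + d` is odd, it is down-pointing, with vertices `u - 1`, `u + 1` (at depth `d`) and `u`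
  (at depth `d + 1`).
-/

/-- Unit triangles of the triangular lattice, encoded as `(u, d)`. -/
abbrev UnitTriangle := ℤ × ℤ

/-- The up-pointing unit triangle `p` shares an edge with `q`: the two slanted edges of `p` are
shared with its neighbours in the same strip, its base with the triangle right below it. -/
def UpAdj (p q : UnitTriangle) : Prop :=
  Even (p.1 + p.2) ∧ (q = (p.1 - 1, p.2) ∨ q = (p.1 + 1, p.2) ∨ q = (p.1, p.2 + 1))

/-- A lozenge is the union of two unit triangles sharing an edge; one of the two is up-pointing. -/
def IsLozenge (L : Set UnitTriangle) : Prop :=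
  ∃ p q : UnitTriangle, UpAdj p q ∧ L = {p, q}

/-- `T` is a lozenge tiling of the region `S`: a set of lozenges without overlaps that covers
exactly `S`. -/
def IsLozengeTiling (S : Set UnitTriangle) (T : Set (Set UnitTriangle)) : Prop :=
  (∀ L ∈ T, IsLozenge L) ∧ T.PairwiseDisjoint id ∧ ⋃₀ T = S

/-- The number `M(S)` of lozenge tilings of the region `S`. -/
noncomputable def numTilings (S : Set UnitTriangle) : ℕ :=
  {T : Set (Set UnitTriangle) | IsLozengeTiling S T}.ncard

/-- The up-pointing triangle whose base is the segment from abscissa `l` to abscissa `r`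
on the lattice line of depth `D`. -/
def upTriangle (l r D : ℤ) : Set UnitTriangle :=
  {p | p.2 < D ∧ l + (D - p.2) ≤ p.1 ∧ p.1 ≤ r - (D - p.2)}

/-- The down-pointing triangle whose (upper) base is the segment from abscissa `l` to abscissa `r`
on the lattice line of depth `D`. -/
def downTriangle (l r D : ℤ) : Set UnitTriangle :=
  {p | D ≤ p.2 ∧ l + (p.2 - D) < p.1 ∧ p.1 < r - (p.2 - D)}

/-! ### Operations on finite sequences `(a₁, …, aₙ)` -/

/-- `O(a) = a₁ + a₃ + a₅ + ⋯`. -/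
def oddSum : List ℕ → ℕ
  | [] => 0
  | [t] => t
  | t :: _ :: ts => t + oddSum ts

/-- `E(a) = a₂ + a₄ + a₆ + ⋯`. -/
def evenSum (a : List ℕ) : ℕ := oddSum a.tail

/-- The sequence `(a_m, a_{m-1}, …, a_1)`, where `a_k = 0` for `k` larger than the length. -/
def revPrefix (a : List ℕ) : ℕ → List ℕ
  | 0 => []
  | m + 1 => a.getD m 0 :: revPrefix a m

/-- `(t₁, t₂, …, tₖ) ↦ (c + t₁, t₂, …, tₖ)`; the empty sequence stays empty. -/
def addHead (c : ℕ) : List ℕ → List ℕ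
  | [] => []
  | t :: ts => (c + t) :: ts

/-! ### Trapezoids with a vertical zigzag western side -/

/-- The trapezoidal region with northern side of length `N`, from abscissa `0` to `2 * N` on the
line of depth `0`, with a straight northeastern side of length `m` (running down to the right), and
whose western side is the vertical zigzag path through the lattice points of abscissas
`0, -1, 0, -1, …` at depths `0, 1, 2, 3, …`. The unit triangles to the east of that zigzag are
those with `0 ≤ u`. -/
def trapezoid (N m : ℤ) : Set UnitTriangle :=
  {p | 0 ≤ p.2 ∧ p.2 < m ∧ 0 ≤ p.1 ∧ p.1 ≤ 2 * N + p.2}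

/-- The up-pointing triangles of sides `t₂, t₄, …` whose bases lie on the line of depth `D`,
from left to right, the first one at distance `t₁` from the point of abscissa `l`,
and with distances `t₃, t₅, …` between consecutive ones. -/
def baseHoles (D : ℤ) (l : ℤ) : List ℕ → Set UnitTriangle
  | [] => ∅
  | [_] => ∅
  | t :: t' :: ts =>
      upTriangle (l + 2 * t) (l + 2 * t + 2 * t') D ∪ baseHoles D (l + 2 * t + 2 * t') ts

/-- The quartered hexagon `𝒬(t₁, …, t₂ₗ)`: the trapezoid with northern, northeastern and southern
sides `O(t)`, `2 E(t)`, `E(t) + O(t)`, with triangles of sides `t₂, t₄, …` removed from the base.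
The left end of the base has abscissa `0`, since its depth is even. -/
def regionQ (t : List ℕ) : Set UnitTriangle :=
  trapezoid (oddSum t) (2 * evenSum t) \ baseHoles (2 * evenSum t) 0 t

/-- The quartered hexagon `𝒦(t₁, …, t₂ₗ)`: the trapezoid with northern, northeastern and southern
sides `O(t)`, `2 E(t) - 1`, `E(t) + O(t)`, with triangles of sides `t₂, t₄, …` removed from the
base. The left end of the base has abscissa `-1`, since its depth is odd.
If `E(t) = 0`, the region is empty. -/
def regionK (t : List ℕ) : Set UnitTriangle :=
  trapezoid (oddSum t) (2 * evenSum t - 1) \ baseHoles (2 * evenSum t - 1) (-1) t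

/-! ### The halved hexagon with an array of triangles removed -/

/-- Array of adjacent triangles of sides `a₁, a₂, …`, from right to left, with bases on
the line of depth `D`, starting at the point of abscissa `r`; they are alternately up- and
down-pointing, the first one being up-pointing iff `up` is true. -/
def fern (D : ℤ) : Bool → ℤ → List ℕ → Set UnitTriangle
  | _, _, [] => ∅
  | true, r, k :: ks => upTriangle (r - 2 * k) r D ∪ fern D false (r - 2 * k) ks
  | false, r, k :: ks => downTriangle (r - 2 * k) r D ∪ fern D true (r - 2 * k) ks

/-- Halved hexagon with northern side of length `N`, from abscissa `0` to `2 * N` at depth `0`,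
with northeastern side of length `A` (so that the rightmost vertex has abscissa `2 * N + A` and
depth `A`), with southeastern side of length `B`, running down to the left, and whose western side
is the vertical zigzag path through the points of abscissas `0, -1, 0, -1, …, 0` at depths
`0, 1, 2, 3, …, A + B`. -/
def halvedHexagon (N A B : ℤ) : Set UnitTriangle :=
  {p | 0 ≤ p.2 ∧ p.2 < A + B ∧ 0 ≤ p.1 ∧ p.1 ≤ 2 * N + p.2 ∧ p.1 + p.2 < 2 * N + 2 * A}

/-- The region `ℛ_{x,y,z}(a₁, …, aₙ)`: the halved hexagon with northern, northeastern,
southeastern, southern sides `x + E(a)`, `y + z + 2 O(a) - 1`, `y + z + 2 E(a) - 1`, `x + O(a)` and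
with `y + z + a₁ + ⋯ + aₙ - 1` zigzag steps (each of height two strips) on the western side, from
which an array of alternating triangles of sides `a₁, …, aₙ`, from right to left, is removed. The
bases of these triangles lie on the lattice line that meets the northeastern side at distance `z`
from the rightmost vertex; the triangles of odd index are up-pointing. Only for `y = z = 0`, `n = 1`
would the southeastern length be `-1`; the inequalities then describe the part of the trapezoid
in the top `2 * a₁ - 2` strips. -/
def regionR (x y z : ℕ) (a : List ℕ) : Set UnitTriangle :=
  halvedHexagon (x + evenSum a) (y + z + 2 * oddSum a - 1) (y + z + 2 * evenSum a - 1) \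
    fern (y + 2 * oddSum a - 1) true (2 * (x + evenSum a) + (y + 2 * oddSum a - 1)) a

/-! ### Counting functions -/

/-- The number of tilings of `𝒬(t)`. -/
noncomputable def numQ (t : List ℕ) : ℕ := numTilings (regionQ t)

/-- The number of tilings of `𝒦(t)`. -/
noncomputable def numK (t : List ℕ) : ℕ := numTilings (regionK t)

/-- The hyperfactorial `H(n) = 0! 1! 2! ⋯ (n-1)!`. -/
def hyperfact (n : ℕ) : ℕ := ∏ k ∈ Finset.range n, k.factorial

/-- The skipping hyperfactorial: `H₂(n) = 0! 2! 4! ⋯ (n-2)!` for even `n` and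
`H₂(n) = 1! 3! 5! ⋯ (n-2)!` for odd `n`. -/
def skipHyperfact : ℕ → ℕ
  | 0 => 1
  | 1 => 1
  | n + 2 => skipHyperfact n * n.factorial

end HalvedHexagon

/-!
Cut the region along the lattice line that carries the removed triangles, and sum over the set `X`
of lozenges crossing this line. Forced lozenges turn each of the two halves (the lower one
reflected) into a trapezoid with unit dents along its base, at the positions of `X` and at those
covered by the removed triangles of one of the two orientations. Counting by strips, the tilings of
a dented trapezoid are given by a determinant of binomial coefficients, which is a Vandermonde
product in the positions of the dents. To the east of the positions of `X`, each position of the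
line is covered by exactly one removed triangle, pointing up or down; hence, in the product of the
two counts, the factors that mix `X` with the removed triangles depend on `s(a) + z` only, and the
sum over `X` factors out. Its value is read off from the case of the empty sequence, in which the
region is itself a quartered hexagon.
-/

namespace HalvedHexagon

/-! ### Tilings: gluing, forced lozenges, reflection, cutting along a lattice line -/

/-- Two unit triangles sharing an edge, whichever of them is up-pointing: the symmetric version of
`UpAdj`. -/
def Adj (p q : UnitTriangle) : Prop := UpAdj p q ∨ UpAdj q p

theorem adj_iff {p q : UnitTriangle} : Adj p q ↔
    q = (p.1 - 1, p.2) ∨ q = (p.1 + 1, p.2) ∨ (Even (p.1 + p.2) ∧ q = (p.1, p.2 + 1)) ∨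
      (Odd (p.1 + p.2) ∧ q = (p.1, p.2 - 1)) := by
  obtain ⟨a, b⟩ := p
  obtain ⟨c, d⟩ := q
  simp only [Adj, UpAdj, Prod.mk.injEq, Int.even_iff, Int.odd_iff]
  omega

theorem isLozenge_pair {p q : UnitTriangle} (h : Adj p q) : IsLozenge {p, q} := by
  rcases h with h | h
  · exact ⟨p, q, h, rfl⟩
  · exact ⟨q, p, h, Set.pair_comm p q⟩

theorem IsLozenge.exists_adj {L : Set UnitTriangle} (hL : IsLozenge L) {p : UnitTriangle}
    (hp : p ∈ L) : ∃ q, Adj p q ∧ L = {p, q} := by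
  obtain ⟨a, b, hab, rfl⟩ := hL
  rcases hp with rfl | hp
  · exact ⟨b, Or.inl hab, rfl⟩
  · obtain rfl : p = b := hp
    exact ⟨a, Or.inr hab, Set.pair_comm a p⟩

theorem IsLozengeTiling.subset {S : Set UnitTriangle} {T} (hT : IsLozengeTiling S T) {L}
    (hL : L ∈ T) : L ⊆ S := by
  rw [← hT.2.2]
  exact Set.subset_sUnion_of_mem hL

theorem IsLozengeTiling.exists_pair_mem {S : Set UnitTriangle} {T} (hT : IsLozengeTiling S T)
    {p : UnitTriangle} (hp : p ∈ S) : ∃ q ∈ S, Adj p q ∧ {p, q} ∈ T := by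
  have hp' := hp
  rw [← hT.2.2] at hp'
  obtain ⟨L, hL, hpL⟩ := hp'
  obtain ⟨q, hq, rfl⟩ := (hT.1 L hL).exists_adj hpL
  exact ⟨q, hT.subset hL (by simp), hq, hL⟩

theorem finite_setOf_isLozengeTiling {S : Set UnitTriangle} (hS : S.Finite) :
    {T | IsLozengeTiling S T}.Finite :=
  (hS.finite_subsets.finite_subsets).subset fun _ hT _ hL => hT.subset hL

theorem isLozengeTiling_empty_iff {T : Set (Set UnitTriangle)} :
    IsLozengeTiling ∅ T ↔ T = ∅ := by
  refine ⟨fun hT => Set.eq_empty_of_forall_notMem fun L hL => ?_, ?_⟩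
  · obtain ⟨p, q, -, rfl⟩ := hT.1 L hL
    exact hT.subset hL (Set.mem_insert p {q})
  · rintro rfl
    exact ⟨by simp, by simp, by simp⟩

theorem numTilings_empty : numTilings ∅ = 1 := by
  simp only [numTilings, isLozengeTiling_empty_iff, Set.ofPred_eq_eq_singleton, Set.ncard_singleton]

theorem isLozengeTiling_singleton {p q : UnitTriangle} (h : Adj p q) :
    IsLozengeTiling {p, q} {{p, q}} :=
  ⟨fun _ hL => hL ▸ isLozenge_pair h, Set.pairwiseDisjoint_singleton _ _, Set.sUnion_singleton _⟩

theorem IsLozengeTiling.union {A B : Set UnitTriangle} {T T'} (hT : IsLozengeTiling A T)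
    (hT' : IsLozengeTiling B T') (h : Disjoint A B) : IsLozengeTiling (A ∪ B) (T ∪ T') :=
  ⟨fun L hL => hL.elim (hT.1 L) (hT'.1 L),
    Set.pairwiseDisjoint_union.2 ⟨hT.2.1, hT'.2.1,
      fun _ hL _ hL' _ => h.mono (hT.subset hL) (hT'.subset hL')⟩,
    by rw [Set.sUnion_union, hT.2.2, hT'.2.2]⟩

theorem IsLozengeTiling.sep_union {A B : Set UnitTriangle} {T T'} (hT : IsLozengeTiling A T)
    (hT' : IsLozengeTiling B T') (h : Disjoint A B) : {L ∈ T ∪ T' | L ⊆ A} = T := by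
  refine Set.Subset.antisymm ?_ fun L hL => ⟨Or.inl hL, hT.subset hL⟩
  rintro L ⟨hL | hL, hLA⟩
  · exact hL
  · obtain ⟨p, q, -, rfl⟩ := hT'.1 L hL
    have hp := Set.mem_insert p {q}
    exact (Set.disjoint_left.1 h (hLA hp) (hT'.subset hL hp)).elim

theorem IsLozengeTiling.sep_subset {S A : Set UnitTriangle} {T} (hT : IsLozengeTiling S T)
    (hA : A ⊆ S) (h : ∀ L ∈ T, L ⊆ A ∨ Disjoint L A) : IsLozengeTiling A {L ∈ T | L ⊆ A} := by
  refine ⟨fun L hL => hT.1 L hL.1, hT.2.1.subset (Set.sep_subset _ _),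
    Set.Subset.antisymm (Set.sUnion_subset fun L hL => hL.2) fun p hp => ?_⟩
  obtain ⟨q, -, -, hL⟩ := hT.exists_pair_mem (hA hp)
  have hpL := Set.mem_insert p {q}
  exact ⟨_, ⟨hL, (h _ hL).resolve_right fun hd => Set.disjoint_left.1 hd hpL hp⟩, hpL⟩

theorem ncard_tilings_glue {A B : Set UnitTriangle} {F : Set (Set UnitTriangle)}
    (hF : IsLozengeTiling (⋃₀ F) F) (hAB : Disjoint A B) (hAF : Disjoint A (⋃₀ F))
    (hBF : Disjoint B (⋃₀ F)) :
    {T | IsLozengeTiling (A ∪ (B ∪ ⋃₀ F)) T ∧ F ⊆ T ∧ ∀ L ∈ T, L ⊆ A ∨ L ⊆ B ∨ L ∈ F}.ncard =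
      numTilings A * numTilings B := by
  have hA' : Disjoint A (B ∪ ⋃₀ F) := Set.disjoint_union_right.2 ⟨hAB, hAF⟩
  have hB' : Disjoint B (A ∪ ⋃₀ F) := Set.disjoint_union_right.2 ⟨hAB.symm, hBF⟩
  have himage :
      {T | IsLozengeTiling (A ∪ (B ∪ ⋃₀ F)) T ∧ F ⊆ T ∧ ∀ L ∈ T, L ⊆ A ∨ L ⊆ B ∨ L ∈ F} =
      (fun T : Set (Set UnitTriangle) × Set (Set UnitTriangle) => T.1 ∪ (T.2 ∪ F)) ''
        ({T | IsLozengeTiling A T} ×ˢ {T | IsLozengeTiling B T}) := by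
    ext T
    constructor
    · rintro ⟨hT, hFT, hsep⟩
      have hdisj : ∀ L ∈ F, Disjoint L A ∧ Disjoint L B := fun L hL =>
        ⟨(hAF.mono_right (hF.subset hL)).symm, (hBF.mono_right (hF.subset hL)).symm⟩
      have hTA := hT.sep_subset (A := A) Set.subset_union_left fun L hL =>
        (hsep L hL).imp_right fun h => h.elim (fun h => hAB.symm.mono_left h) fun h => (hdisj L h).1
      have hTB := hT.sep_subset (A := B) (Set.subset_union_left.trans Set.subset_union_right)
        fun L hL => (hsep L hL).elim (fun h => Or.inr (hAB.mono_left h))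
          fun h => h.imp_right fun h => (hdisj L h).2
      refine ⟨(_, _), ⟨hTA, hTB⟩, Set.Subset.antisymm ?_ fun L hL => ?_⟩
      · exact Set.union_subset (Set.sep_subset _ _) (Set.union_subset (Set.sep_subset _ _) hFT)
      · exact (hsep L hL).imp (⟨hL, ·⟩) (Or.imp_left (⟨hL, ·⟩))
    · rintro ⟨⟨T₁, T₂⟩, ⟨hT₁, hT₂⟩, rfl⟩
      refine ⟨hT₁.union (hT₂.union hF hBF) hA',
        Set.subset_union_right.trans Set.subset_union_right, fun L hL => ?_⟩
      exact hL.imp (fun h => hT₁.subset h) (Or.imp_left fun h => hT₂.subset h)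
  rw [himage, Set.InjOn.ncard_image, Set.ncard_prod]
  · rfl
  · rintro ⟨T₁, T₂⟩ ⟨hT₁, hT₂⟩ ⟨T₁', T₂'⟩ ⟨hT₁', hT₂'⟩ (h : T₁ ∪ (T₂ ∪ F) = T₁' ∪ (T₂' ∪ F))
    have h' : T₂ ∪ (T₁ ∪ F) = T₂' ∪ (T₁' ∪ F) := by
      rw [Set.union_left_comm, h, Set.union_left_comm]
    refine Prod.ext ?_ ?_
    · rw [← hT₁.sep_union (hT₂.union hF hBF) hA', h, hT₁'.sep_union (hT₂'.union hF hBF) hA']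
    · rw [← hT₂.sep_union (hT₁.union hF hAF) hB', h', hT₂'.sep_union (hT₁'.union hF hAF) hB']

theorem numTilings_eq_zero_of_forall_not_adj {S : Set UnitTriangle} {p : UnitTriangle} (hp : p ∈ S)
    (h : ∀ q ∈ S, ¬ Adj p q) : numTilings S = 0 := by
  have : {T | IsLozengeTiling S T} = ∅ := by
    refine Set.eq_empty_of_forall_notMem fun T hT => ?_
    obtain ⟨q, hq, hpq, -⟩ := IsLozengeTiling.exists_pair_mem hT hp
    exact h q hq hpq
  rw [numTilings, this, Set.ncard_empty]

theorem numTilings_eq_numTilings_sdiff_pair {S : Set UnitTriangle} {p q : UnitTriangle}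
    (hp : p ∈ S) (hq : q ∈ S) (hpq : Adj p q) (h : ∀ r ∈ S, Adj p r → r = q) :
    numTilings S = numTilings (S \ {p, q}) := by
  have hS : S \ {p, q} ∪ (∅ ∪ ⋃₀ {{p, q}}) = S := by
    rw [Set.empty_union, Set.sUnion_singleton, Set.sdiff_union_of_subset (Set.pair_subset hp hq)]
  have hglue := ncard_tilings_glue (A := S \ {p, q}) (B := ∅) (F := {{p, q}})
    (by simpa only [Set.sUnion_singleton] using isLozengeTiling_singleton hpq)
    (Set.disjoint_empty _) (by rw [Set.sUnion_singleton]; exact Set.disjoint_sdiff_left)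
    (Set.empty_disjoint _)
  rw [hS, numTilings_empty, mul_one] at hglue
  rw [← hglue, numTilings]
  congr 1
  ext T
  refine ⟨fun hT => ?_, And.left⟩
  obtain ⟨r, hr, hpr, hforced⟩ := IsLozengeTiling.exists_pair_mem hT hp
  rw [h r hr hpr] at hforced
  refine ⟨hT, Set.singleton_subset_iff.2 hforced, fun L hL => ?_⟩
  by_cases hLpq : L = {p, q}
  · exact Or.inr (Or.inr hLpq)
  · exact Or.inl (Set.subset_sdiff.2 ⟨hT.subset hL, hT.2.1 hL hforced hLpq⟩)

theorem IsLozengeTiling.image {S : Set UnitTriangle} {T} (hT : IsLozengeTiling S T)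
    {f : UnitTriangle → UnitTriangle} (hf : f.Injective) (hadj : ∀ p q, Adj p q → Adj (f p) (f q)) :
    IsLozengeTiling (f '' S) (Set.image f '' T) := by
  refine ⟨?_, ?_, by rw [← hT.2.2, Set.image_sUnion]⟩
  · rintro _ ⟨L, hL, rfl⟩
    obtain ⟨p, q, hpq, rfl⟩ := hT.1 L hL
    rw [Set.image_pair]
    exact isLozenge_pair (hadj p q (Or.inl hpq))
  · rintro _ ⟨L, hL, rfl⟩ _ ⟨L', hL', rfl⟩ hne
    exact (Set.disjoint_image_iff hf).2 (hT.2.1 hL hL' fun h => hne (h ▸ rfl))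

theorem numTilings_preimage_of_involutive {f : UnitTriangle → UnitTriangle} (hf : f.Involutive)
    (hadj : ∀ p q, Adj p q → Adj (f p) (f q)) (S : Set UnitTriangle) :
    numTilings (f ⁻¹' S) = numTilings S := by
  have hf₁ : (Set.image f).Involutive := fun L => by
    rw [← Set.image_comp, hf.comp_self, Set.image_id]
  have hf₂ : (Set.image (Set.image f)).Involutive := fun T => by
    rw [← Set.image_comp, hf₁.comp_self, Set.image_id]
  rw [← Set.image_eq_preimage_of_inverse hf hf, numTilings, numTilings,
    ← Set.ncard_image_of_injective {T | IsLozengeTiling S T} hf₂.injective]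
  congr 1
  ext T
  refine ⟨fun hT => ⟨_, ?_, hf₂ T⟩, ?_⟩
  · have := IsLozengeTiling.image hT hf.injective hadj
    rwa [hf₁ S] at this
  · rintro ⟨T, hT, rfl⟩
    exact IsLozengeTiling.image hT hf.injective hadj

/-- The reflection exchanges up- and down-pointing unit triangles because `c` is odd. -/
theorem numTilings_reflect (S : Set UnitTriangle) {c : ℤ} (hc : Odd c) :
    numTilings {p | (p.1, c - p.2) ∈ S} = numTilings S := by
  refine numTilings_preimage_of_involutive (f := fun p => (p.1, c - p.2)) (fun p => by simp) ?_ S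
  rintro ⟨u, d⟩ ⟨u', d'⟩ h
  rw [adj_iff] at h ⊢
  simp only [Prod.mk.injEq, Int.even_iff, Int.odd_iff] at *
  omega

/-- The unit triangles of the strip `d` with abscissas `2 * i + e`, `i ∈ X`: the dents at the
positions `X` of a lattice line. -/
def dentRow (e d : ℤ) (X : Finset ℕ) : Set UnitTriangle :=
  {p | p.2 = d ∧ ∃ i ∈ X, p.1 = 2 * (i : ℤ) + e}

theorem dentRow_union (e d : ℤ) (X Y : Finset ℕ) :
    dentRow e d (X ∪ Y) = dentRow e d X ∪ dentRow e d Y := by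
  ext p
  simp only [dentRow, Finset.mem_union, Set.mem_ofPred_eq, Set.mem_union]
  constructor
  · rintro ⟨h, i, hi | hi, h'⟩
    exacts [Or.inl ⟨h, i, hi, h'⟩, Or.inr ⟨h, i, hi, h'⟩]
  · rintro (⟨h, i, hi, h'⟩ | ⟨h, i, hi, h'⟩)
    exacts [⟨h, i, Or.inl hi, h'⟩, ⟨h, i, Or.inr hi, h'⟩]

/-- The vertical lozenges crossing the lattice line of depth `D` at the positions `X`. -/
def crossingLozenges (e D : ℤ) (X : Finset ℕ) : Set (Set UnitTriangle) :=
  {L | ∃ i ∈ X, L = {(2 * (i : ℤ) + e, D - 1), (2 * (i : ℤ) + e, D)}}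

theorem sUnion_crossingLozenges (e D : ℤ) (X : Finset ℕ) :
    ⋃₀ crossingLozenges e D X = dentRow e (D - 1) X ∪ dentRow e D X := by
  ext ⟨u, d⟩
  simp only [crossingLozenges, dentRow, Set.mem_sUnion, Set.mem_ofPred_eq, Set.mem_union]
  constructor
  · rintro ⟨_, ⟨i, hi, rfl⟩, hp | hp⟩ <;> obtain ⟨rfl, rfl⟩ := Prod.mk.inj hp
    exacts [Or.inl ⟨rfl, i, hi, rfl⟩, Or.inr ⟨rfl, i, hi, rfl⟩]
  · rintro (⟨rfl, i, hi, rfl⟩ | ⟨rfl, i, hi, rfl⟩)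
    exacts [⟨_, ⟨i, hi, rfl⟩, Or.inl rfl⟩, ⟨_, ⟨i, hi, rfl⟩, Or.inr rfl⟩]

theorem adj_crossing {u D : ℤ} (h : Odd (u + D)) : Adj (u, D - 1) (u, D) := by
  rw [← Int.not_even_iff_odd] at h
  exact Or.inl ⟨by rw [← add_sub_assoc]; exact Int.even_sub_one.2 h, by simp⟩

theorem isLozengeTiling_crossingLozenges {e D : ℤ} {X : Finset ℕ}
    (h : ∀ i ∈ X, Odd (2 * (i : ℤ) + e + D)) :
    IsLozengeTiling (⋃₀ crossingLozenges e D X) (crossingLozenges e D X) := by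
  refine ⟨?_, ?_, rfl⟩
  · rintro _ ⟨i, hi, rfl⟩
    exact isLozenge_pair (adj_crossing (h i hi))
  · rintro _ ⟨i, -, rfl⟩ _ ⟨j, -, rfl⟩ hne
    have hij : i ≠ j := fun h => hne (h ▸ rfl)
    refine Set.disjoint_left.2 ?_
    simp only [id, Set.mem_insert_iff, Set.mem_singleton_iff, Prod.forall, Prod.mk.injEq]
    omega

theorem IsLozenge.above_or_below_or_crossing {L : Set UnitTriangle} (hL : IsLozenge L) (D : ℤ) :
    (∀ p ∈ L, p.2 < D) ∨ (∀ p ∈ L, D ≤ p.2) ∨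
      ∃ u, Odd (u + D) ∧ L = {(u, D - 1), (u, D)} := by
  obtain ⟨⟨u, d⟩, q, ⟨hpar, hq⟩, rfl⟩ := hL
  simp only [Set.mem_insert_iff, Set.mem_singleton_iff, forall_eq_or_imp, forall_eq]
  rcases hq with rfl | rfl | rfl
  · exact (lt_or_ge d D).imp (fun h => ⟨h, h⟩) fun h => Or.inl ⟨h, h⟩
  · exact (lt_or_ge d D).imp (fun h => ⟨h, h⟩) fun h => Or.inl ⟨h, h⟩
  · rcases lt_trichotomy (d + 1) D with h | rfl | h
    · exact Or.inl ⟨by simpa using by omega, h⟩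
    · refine Or.inr (Or.inr ⟨u, ?_, by simp⟩)
      rw [← add_assoc]
      exact hpar.add_one
    · exact Or.inr (Or.inl ⟨by simpa using by omega, h.le⟩)

theorem sides_sdiff_dentRow_union {S : Set UnitTriangle} {D e : ℤ} {X : Finset ℕ}
    (hX : ∀ i ∈ X, (2 * (i : ℤ) + e, D - 1) ∈ S ∧ (2 * (i : ℤ) + e, D) ∈ S) :
    {p ∈ S | p.2 < D} \ dentRow e (D - 1) X ∪ ({p ∈ S | D ≤ p.2} \ dentRow e D X ∪
      (dentRow e (D - 1) X ∪ dentRow e D X)) = S := by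
  have habove : dentRow e (D - 1) X ⊆ {p ∈ S | p.2 < D} := by
    rintro ⟨u, d⟩ ⟨rfl, i, hi, rfl⟩
    exact ⟨(hX i hi).1, sub_one_lt D⟩
  have hbelow : dentRow e D X ⊆ {p ∈ S | D ≤ p.2} := by
    rintro ⟨u, d⟩ ⟨rfl, i, hi, rfl⟩
    exact ⟨(hX i hi).2, le_rfl⟩
  rw [Set.union_comm (dentRow e (D - 1) X), ← Set.union_assoc (_ \ _) (dentRow e D X),
    Set.sdiff_union_of_subset hbelow, Set.union_left_comm, Set.sdiff_union_of_subset habove]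
  ext p
  simp only [Set.mem_union, Set.mem_ofPred_eq, ← and_or_left, le_or_gt, and_true]

theorem disjoint_sides_sdiff_dentRow {S : Set UnitTriangle} (D e : ℤ) (X : Finset ℕ) :
    Disjoint ({p ∈ S | p.2 < D} \ dentRow e (D - 1) X) ({p ∈ S | D ≤ p.2} \ dentRow e D X) ∧
      Disjoint ({p ∈ S | p.2 < D} \ dentRow e (D - 1) X) (dentRow e (D - 1) X ∪ dentRow e D X) ∧
      Disjoint ({p ∈ S | D ≤ p.2} \ dentRow e D X) (dentRow e (D - 1) X ∪ dentRow e D X) := by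
  refine ⟨Set.disjoint_left.2 fun p hp hp' => (hp.1.2.trans_le hp'.1.2).false,
    Set.disjoint_left.2 fun p hp hp' => hp'.elim hp.2 fun h => ?_,
    Set.disjoint_left.2 fun p hp hp' => hp'.elim (fun h => ?_) hp.2⟩
  · exact (hp.1.2.trans_eq h.1.symm).false
  · exact (hp.1.2.trans_eq h.1).not_gt (sub_one_lt D)

theorem ncard_tilings_of_crossing {S : Set UnitTriangle} {D e : ℤ} {X : Finset ℕ}
    (hX : ∀ i ∈ X, Odd (2 * (i : ℤ) + e + D) ∧ (2 * (i : ℤ) + e, D - 1) ∈ S ∧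
      (2 * (i : ℤ) + e, D) ∈ S) :
    {T | IsLozengeTiling S T ∧ ∀ u, Odd (u + D) →
      (({(u, D - 1), (u, D)} : Set UnitTriangle) ∈ T ↔ ∃ i ∈ X, u = 2 * (i : ℤ) + e)}.ncard =
      numTilings ({p ∈ S | p.2 < D} \ dentRow e (D - 1) X) *
        numTilings ({p ∈ S | D ≤ p.2} \ dentRow e D X) := by
  have hFU := sUnion_crossingLozenges e D X
  set F := crossingLozenges e D X
  obtain ⟨hAB, hAF, hBF⟩ := disjoint_sides_sdiff_dentRow (S := S) D e X
  rw [← hFU] at hAF hBF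
  rw [← ncard_tilings_glue (isLozengeTiling_crossingLozenges fun i hi => (hX i hi).1) hAB hAF hBF,
    hFU, sides_sdiff_dentRow_union fun i hi => (hX i hi).2]
  congr 1
  ext T
  refine and_congr_right fun hT => ⟨fun hcross => ?_, fun ⟨hFT, hsep⟩ u hu => ⟨fun hL => ?_, ?_⟩⟩
  · have hFT : F ⊆ T := by
      rintro _ ⟨i, hi, rfl⟩
      exact (hcross _ (hX i hi).1).2 ⟨i, hi, rfl⟩
    refine ⟨hFT, fun L hL => ?_⟩
    by_cases hLF : L ∈ F
    · exact Or.inr (Or.inr hLF)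
    have hLU : Disjoint L (⋃₀ F) := Set.disjoint_sUnion_right.2 fun L' hL' =>
      hT.2.1 hL (hFT hL') fun h => hLF (h ▸ hL')
    rw [hFU, Set.disjoint_union_right] at hLU
    rcases (hT.1 L hL).above_or_below_or_crossing D with h | h | ⟨u, hu, rfl⟩
    · exact Or.inl (Set.subset_sdiff.2 ⟨fun p hp => ⟨hT.subset hL hp, h p hp⟩, hLU.1⟩)
    · exact Or.inr (Or.inl (Set.subset_sdiff.2 ⟨fun p hp => ⟨hT.subset hL hp, h p hp⟩, hLU.2⟩))
    · obtain ⟨i, hi, rfl⟩ := (hcross u hu).1 hL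
      exact (hLF ⟨i, hi, rfl⟩).elim
  · rcases hsep _ hL with h | h | ⟨i, hi, h⟩
    · exact absurd (h (Set.mem_insert_of_mem _ rfl)).1.2 (lt_irrefl D)
    · exact absurd (h (Set.mem_insert _ _)).1.2 (not_le.2 (sub_one_lt D))
    · have := h.subset (Set.mem_insert _ _)
      simp only [Set.mem_insert_iff, Set.mem_singleton_iff, Prod.mk.injEq] at this
      exact ⟨i, hi, by omega⟩
  · rintro ⟨i, hi, rfl⟩
    exact hFT ⟨i, hi, rfl⟩

theorem numTilings_cut {S : Set UnitTriangle} (hS : S.Finite) (D e : ℤ) (P : Finset ℕ)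
    (hP : ∀ u : ℤ, (Odd (u + D) ∧ (u, D - 1) ∈ S ∧ (u, D) ∈ S) ↔ ∃ i ∈ P, u = 2 * (i : ℤ) + e) :
    numTilings S = ∑ X ∈ P.powerset,
      numTilings ({p ∈ S | p.2 < D} \ dentRow e (D - 1) X) *
        numTilings ({p ∈ S | D ≤ p.2} \ dentRow e D X) := by
  classical
  have hfin := finite_setOf_isLozengeTiling hS
  let crossing (T : Set (Set UnitTriangle)) : Finset ℕ :=
    {i ∈ P | ({(2 * (i : ℤ) + e, D - 1), (2 * (i : ℤ) + e, D)} : Set UnitTriangle) ∈ T}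
  rw [numTilings, Set.ncard_eq_toFinset_card _ hfin, Finset.card_eq_sum_card_fiberwise
    (f := crossing) (t := P.powerset) fun T _ => Finset.mem_powerset.2 (Finset.filter_subset _ _)]
  refine Finset.sum_congr rfl fun X hX => ?_
  have hXP := Finset.mem_powerset.1 hX
  rw [← ncard_tilings_of_crossing fun i hi => (hP _).2 ⟨i, hXP hi, rfl⟩, ← Set.ncard_coe_finset]
  congr 1
  ext T
  simp only [Finset.coe_filter, Set.Finite.mem_toFinset, Set.mem_ofPred_eq]
  refine and_congr_right fun hT => ⟨?_, fun hcross => ?_⟩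
  · rintro rfl u hu
    simp only [crossing, Finset.mem_filter]
    refine ⟨fun hL => ?_, by rintro ⟨i, ⟨-, hL⟩, rfl⟩; exact hL⟩
    obtain ⟨i, hi, rfl⟩ := (hP u).1
      ⟨hu, hT.subset hL (Set.mem_insert _ _), hT.subset hL (Set.mem_insert_of_mem _ rfl)⟩
    exact ⟨i, ⟨hi, hL⟩, rfl⟩
  · ext i
    rw [Finset.mem_filter]
    constructor
    · rintro ⟨hi, hL⟩
      obtain ⟨j, hj, hij⟩ := (hcross _ ((hP _).2 ⟨i, hi, rfl⟩).1).1 hL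
      rwa [show i = j by omega]
    · intro hi
      exact ⟨hXP hi, (hcross _ ((hP _).2 ⟨i, hXP hi, rfl⟩).1).2 ⟨i, hi, rfl⟩⟩

/-! ### Tilings of a single strip -/

/-- The part of the strip `d` between the abscissas `a` and `W`, with the unit triangles of
abscissas in `Y` (the dents of the strip) removed. -/
def rowSet (d a W : ℤ) (Y : Set ℤ) : Set UnitTriangle :=
  {p | p.2 = d ∧ a ≤ p.1 ∧ p.1 ≤ W ∧ p.1 ∉ Y}

theorem rowSet_congr {d a W : ℤ} {Y Y' : Set ℤ} (h : ∀ u, a ≤ u → u ≤ W → (u ∈ Y ↔ u ∈ Y')) :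
    rowSet d a W Y = rowSet d a W Y' :=
  Set.ext fun p => and_congr_right fun _ => and_congr_right fun ha => and_congr_right fun hW =>
    not_congr (h p.1 ha hW)

theorem rowSet_eq_rowSet_add_one {d a W : ℤ} {Y : Set ℤ} (ha : a ∈ Y) :
    rowSet d a W Y = rowSet d (a + 1) W Y :=
  Set.ext fun _ => and_congr_right fun _ =>
    ⟨fun h => ⟨lt_of_le_of_ne h.1 fun hp => h.2.2 (hp ▸ ha), h.2⟩,
      fun h => ⟨(lt_add_one a).le.trans h.1, h.2⟩⟩

theorem rowSet_eq_empty {d a W : ℤ} {Y : Set ℤ} (h : W < a) : rowSet d a W Y = ∅ :=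
  Set.eq_empty_of_forall_notMem fun _ hp => ((hp.2.1.trans hp.2.2.1).trans_lt h).false

theorem numTilings_rowSet_add_two {d a W : ℤ} {Y : Set ℤ} (h₀ : a ∉ Y) (h₁ : a + 1 ∉ Y)
    (hW : a + 1 ≤ W) : numTilings (rowSet d a W Y) = numTilings (rowSet d (a + 2) W Y) := by
  rw [numTilings_eq_numTilings_sdiff_pair (p := (a, d)) (q := (a + 1, d))]
  · congr 1
    ext ⟨u, v⟩
    simp only [rowSet, Set.mem_sdiff, Set.mem_ofPred_eq, Set.mem_insert_iff, Prod.mk.injEq,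
      Set.mem_singleton_iff]
    constructor
    · rintro ⟨⟨hv, hu, huW, huY⟩, hne⟩
      exact ⟨hv, by omega, huW, huY⟩
    · rintro ⟨hv, hu, huW, huY⟩
      exact ⟨⟨hv, by omega, huW, huY⟩, by omega⟩
  · exact ⟨rfl, le_rfl, by omega, h₀⟩
  · exact ⟨rfl, by simp, hW, h₁⟩
  · exact adj_iff.2 (by simp)
  · rintro ⟨u, v⟩ ⟨hv, hu, -, -⟩ hadj
    rw [adj_iff] at hadj
    simp only [Prod.mk.injEq] at *
    omega

theorem numTilings_rowSet_eq_zero_of_isolated {d a W : ℤ} {Y : Set ℤ} (h₀ : a ∉ Y) (haW : a ≤ W)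
    (h₁ : a + 1 ∈ Y ∨ W < a + 1) : numTilings (rowSet d a W Y) = 0 := by
  refine numTilings_eq_zero_of_forall_not_adj (p := (a, d)) ⟨rfl, le_rfl, haW, h₀⟩ ?_
  rintro ⟨u, v⟩ ⟨hv, hu, huW, huY⟩ hadj
  rw [adj_iff] at hadj
  simp only [Prod.mk.injEq] at *
  obtain rfl : u = a + 1 := by omega
  exact h₁.elim huY huW.not_gt

theorem numTilings_rowSet_add_two_mul {d W : ℤ} {Y : Set ℤ} (l : ℕ) : ∀ a : ℤ,
    (∀ u, a ≤ u → u < a + 2 * l → u ∉ Y) → a + 2 * l ≤ W + 1 →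
    numTilings (rowSet d a W Y) = numTilings (rowSet d (a + 2 * l) W Y) := by
  induction l with
  | zero => simp
  | succ l ih =>
    intro a hY hW
    push_cast at hY hW ⊢
    rw [numTilings_rowSet_add_two (hY a (by omega) (by omega)) (hY _ (by omega) (by omega))
      (by omega), ih (a + 2) (fun u h₁ h₂ => hY u (by omega) (by omega)) (by omega)]
    congr 2
    ring

theorem numTilings_rowSet_of_first_dent {d a W x : ℤ} {Y : Set ℤ} (hx : x ∈ Y) (hax : a ≤ x)
    (hxW : x ≤ W) (hmin : ∀ u, a ≤ u → u < x → u ∉ Y) :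
    numTilings (rowSet d a W Y) =
      if Even (x - a) then numTilings (rowSet d (x + 1) W Y) else 0 := by
  split_ifs with h
  · obtain ⟨l, hl⟩ := h
    lift l to ℕ using by omega
    rw [numTilings_rowSet_add_two_mul l a (fun u h₁ h₂ => hmin u h₁ (by omega)) (by omega),
      show a + 2 * (l : ℤ) = x by omega, rowSet_eq_rowSet_add_one hx]
  · obtain ⟨l, hl⟩ := Int.not_even_iff_odd.1 h
    lift l to ℕ using by omega
    rw [numTilings_rowSet_add_two_mul l a (fun u h₁ h₂ => hmin u h₁ (by omega)) (by omega)]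
    refine numTilings_rowSet_eq_zero_of_isolated (hmin _ (by omega) (by omega)) (by omega) ?_
    exact Or.inl (by rwa [show a + 2 * (l : ℤ) + 1 = x by omega])

theorem numTilings_rowSet_of_no_dent {d a W : ℤ} {Y : Set ℤ} (haW : a ≤ W + 1)
    (hmin : ∀ u, a ≤ u → u ≤ W → u ∉ Y) :
    numTilings (rowSet d a W Y) = if Even (W + 1 - a) then 1 else 0 := by
  split_ifs with h
  · obtain ⟨l, hl⟩ := h
    lift l to ℕ using by omega
    rw [numTilings_rowSet_add_two_mul l a (fun u h₁ h₂ => hmin u h₁ (by omega)) (by omega),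
      rowSet_eq_empty (by omega), numTilings_empty]
  · obtain ⟨l, hl⟩ := Int.not_even_iff_odd.1 h
    lift l to ℕ using by omega
    rw [numTilings_rowSet_add_two_mul l a (fun u h₁ h₂ => hmin u h₁ (by omega)) (by omega)]
    exact numTilings_rowSet_eq_zero_of_isolated (hmin _ (by omega) (by omega)) (by omega)
      (Or.inr (by omega))

/-- The abscissas of dents at the positions `S` of the lower boundary line of a strip and at the
positions `C` of the upper one. The unit triangle at position `i` of the upper line lies between
those at the positions `i` and `i + 1` of the lower line. -/
def stripDents (o : ℤ) (S C : Set ℕ) : Set ℤ :=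
  {u | (∃ i ∈ S, u = 2 * (i : ℤ) + o) ∨ ∃ i ∈ C, u = 2 * (i : ℤ) + (o + 1)}

section StripDents

variable {d o : ℤ} {S C : Set ℕ} {l w : ℕ}

theorem numTilings_rowSet_stripDents_eq_zero_of_upper_first (hlw : l ≤ w)
    (h : ∀ i ∈ S, l ≤ i → i ≤ w → ∃ c ∈ C, l ≤ c ∧ c < i) :
    numTilings (rowSet d (2 * l + o) (2 * w + o) (stripDents o S C)) = 0 := by
  by_cases hC : ∃ c, c ∈ C ∧ l ≤ c ∧ c < w
  · classical
    obtain ⟨hc, hlc, hcw⟩ := Nat.find_spec hC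
    have hmin : ∀ i ∈ C, l ≤ i → i < w → Nat.find hC ≤ i := fun i hi hli hiw =>
      Nat.find_min' hC ⟨hi, hli, hiw⟩
    generalize Nat.find hC = c at *
    rw [numTilings_rowSet_of_first_dent (Or.inr ⟨c, hc, rfl⟩) (by omega) (by omega), if_neg]
    · rw [Int.even_iff]
      omega
    · rintro _ h₁ h₂ (⟨i, hi, rfl⟩ | ⟨i, hi, rfl⟩)
      · obtain ⟨c', hc', hlc', hc'i⟩ := h i hi (by omega) (by omega)
        have := hmin c' hc' hlc' (by omega)
        omega
      · have := hmin i hi (by omega) (by omega)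
        omega
  · push Not at hC
    rw [numTilings_rowSet_of_no_dent (by omega), if_neg]
    · rw [Int.even_iff]
      omega
    · rintro _ h₁ h₂ (⟨i, hi, rfl⟩ | ⟨i, hi, rfl⟩)
      · obtain ⟨c, hc, hlc, hci⟩ := h i hi (by omega) (by omega)
        have := hC c hc hlc
        omega
      · have := hC i hi (by omega)
        omega

theorem numTilings_rowSet_stripDents_of_lower_first {x : ℕ} (hx : x ∈ S) (hlx : l ≤ x) (hxw : x ≤ w)
    (hS : ∀ i ∈ S, l ≤ i → x ≤ i) (hC : ∀ i ∈ C, l ≤ i → x ≤ i) :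
    numTilings (rowSet d (2 * l + o) (2 * w + o) (stripDents o S C)) =
      numTilings (rowSet d (2 * x + o + 1) (2 * w + o) (stripDents o S C)) := by
  rw [numTilings_rowSet_of_first_dent (Or.inl ⟨x, hx, rfl⟩) (by omega) (by omega), if_pos]
  · exact ⟨x - l, by ring⟩
  · rintro _ h₁ h₂ (⟨i, hi, rfl⟩ | ⟨i, hi, rfl⟩)
    · have := hS i hi (by omega)
      omega
    · have := hC i hi (by omega)
      omega

theorem numTilings_rowSet_stripDents_of_lower_upper {x c : ℕ} (hx : x ∈ S) (hc : c ∈ C)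
    (hlx : l ≤ x) (hxc : x ≤ c) (hcw : c < w) (hS : ∀ i ∈ S, l ≤ i → i ≤ c → i = x)
    (hC : ∀ i ∈ C, l ≤ i → c ≤ i) :
    numTilings (rowSet d (2 * l + o) (2 * w + o) (stripDents o S C)) =
      numTilings (rowSet d (2 * (c + 1 : ℕ) + o) (2 * w + o) (stripDents o S C)) := by
  rw [numTilings_rowSet_stripDents_of_lower_first hx hlx (hxc.trans hcw.le)
    (fun i hi hli => ?_) fun i hi hli => hxc.trans (hC i hi hli),
    numTilings_rowSet_of_first_dent (Or.inr ⟨c, hc, rfl⟩) (by omega) (by omega), if_pos]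
  · congr 2
    push_cast
    ring
  · exact ⟨c - x, by ring⟩
  · rintro _ h₁ h₂ (⟨i, hi, rfl⟩ | ⟨i, hi, rfl⟩)
    · have := hS i hi (by omega) (by omega)
      omega
    · have := hC i hi (by omega)
      omega
  · by_contra! hix
    exact hix.ne (hS i hi hli (hix.le.trans hxc))

theorem numTilings_rowSet_stripDents_eq_zero_of_lower_lower {x x' : ℕ} (hx : x ∈ S) (hx' : x' ∈ S)
    (hlx : l ≤ x) (hxx' : x < x') (hx'w : x' ≤ w) (hS : ∀ i ∈ S, i = x ∨ i < l ∨ x' ≤ i)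
    (hC : ∀ i ∈ C, l ≤ i → x' ≤ i) :
    numTilings (rowSet d (2 * l + o) (2 * w + o) (stripDents o S C)) = 0 := by
  rw [numTilings_rowSet_stripDents_of_lower_first hx hlx (hxx'.le.trans hx'w)
    (fun i hi hli => ?_) fun i hi hli => hxx'.le.trans (hC i hi hli),
    numTilings_rowSet_of_first_dent (Or.inl ⟨x', hx', rfl⟩) (by omega) (by omega), if_neg]
  · rw [Int.even_iff]
    omega
  · rintro _ h₁ h₂ (⟨i, hi, rfl⟩ | ⟨i, hi, rfl⟩)
    · have := hS i hi
      omega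
    · have := hC i hi (by omega)
      omega
  · have := hS i hi
    omega

theorem numTilings_rowSet_stripDents_singleton {C : Finset ℕ} {x : ℕ} (hlx : l ≤ x) (hxw : x ≤ w)
    (hC : ∀ c ∈ C, l ≤ c ∧ c < w) :
    numTilings (rowSet d (2 * l + o) (2 * w + o) (stripDents o {x} C)) =
      if C = ∅ then 1 else 0 := by
  rcases C.eq_empty_or_nonempty with rfl | hne
  · rw [if_pos rfl, Finset.coe_empty,
      numTilings_rowSet_stripDents_of_lower_first (Set.mem_singleton x) hlx hxw
        (fun i hi _ => hi.ge) (by simp), numTilings_rowSet_of_no_dent (by omega), if_pos]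
    · exact ⟨w - x, by ring⟩
    · rintro _ h₁ - (⟨i, rfl, rfl⟩ | ⟨i, hi, -⟩)
      · omega
      · exact hi
  obtain ⟨c, hc, hmin⟩ := C.exists_min_image id hne
  obtain ⟨hlc, hcw⟩ := hC c hc
  rw [if_neg hne.ne_empty]
  rcases lt_or_ge c x with hcx | hxc
  · exact numTilings_rowSet_stripDents_eq_zero_of_upper_first (hlx.trans hxw)
      fun i hi _ _ => ⟨c, hc, hlc, hcx.trans_eq hi.symm⟩
  · rw [numTilings_rowSet_stripDents_of_lower_upper (Set.mem_singleton x) hc hlx hxc hcw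
      (fun i hi _ _ => hi) fun i hi _ => hmin i hi]
    exact numTilings_rowSet_stripDents_eq_zero_of_upper_first hcw fun i hi hci _ =>
      absurd (hci.trans_eq hi) hxc.not_gt

end StripDents

/-- The positions in `C` interlace with the positions `s` of the next lattice line. -/
def Interlaces {n : ℕ} (C : Finset ℕ) (s : Fin (n + 1) → ℕ) : Prop :=
  ∃ t : Fin n → ℕ, (∀ i, s i.castSucc ≤ t i ∧ t i < s i.succ) ∧ C = Finset.univ.image t

theorem image_univ_fin_succ {n : ℕ} (t : Fin (n + 1) → ℕ) :
    Finset.univ.image t = insert (t 0) (Finset.univ.image fun i : Fin n => t i.succ) := by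
  ext c
  simp only [Finset.mem_image, Finset.mem_univ, true_and, Finset.mem_insert, Fin.exists_fin_succ,
    eq_comm]

theorem interlaces_one_iff {C : Finset ℕ} {s : Fin 1 → ℕ} : Interlaces C s ↔ C = ∅ := by
  refine ⟨?_, fun h => ⟨Fin.elim0, fun i => i.elim0, by simpa using h⟩⟩
  rintro ⟨t, -, rfl⟩
  simp

theorem Interlaces.le_of_mem {n : ℕ} {C : Finset ℕ} {s : Fin (n + 1) → ℕ} (h : Interlaces C s)
    (hs : StrictMono s) {c : ℕ} (hc : c ∈ C) : s 0 ≤ c := by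
  obtain ⟨t, ht, rfl⟩ := h
  obtain ⟨i, -, rfl⟩ := Finset.mem_image.1 hc
  exact (hs.monotone (Fin.zero_le _)).trans (ht i).1

theorem Interlaces.exists_lt {n : ℕ} {C : Finset ℕ} {s : Fin (n + 2) → ℕ} (h : Interlaces C s) :
    ∃ c ∈ C, c < s 1 := by
  obtain ⟨t, ht, rfl⟩ := h
  exact ⟨t 0, Finset.mem_image_of_mem t (Finset.mem_univ 0), (ht 0).2⟩

theorem interlaces_succ_iff {n : ℕ} {C : Finset ℕ} {s : Fin (n + 2) → ℕ} (hs : StrictMono s)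
    {c : ℕ} (hc : c ∈ C) (h₀ : s 0 ≤ c) (h₁ : c < s 1) :
    Interlaces C s ↔ Interlaces (C.erase c) fun i => s i.succ := by
  constructor
  · rintro ⟨t, ht, rfl⟩
    have hlt : ∀ a ∈ Finset.univ.image fun i : Fin n => t i.succ, s 1 ≤ a := by
      intro a ha
      obtain ⟨i, -, rfl⟩ := Finset.mem_image.1 ha
      exact (hs.monotone (Fin.one_le_of_ne_zero (by simp [Fin.ext_iff]))).trans (ht i.succ).1
    refine ⟨fun i => t i.succ, fun i => ht i.succ, ?_⟩
    rw [image_univ_fin_succ] at hc ⊢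
    obtain rfl : c = t 0 := (Finset.mem_insert.1 hc).resolve_right fun h => h₁.not_ge (hlt c h)
    exact Finset.erase_insert fun h => h₁.not_ge (hlt _ h)
  · rintro ⟨t, ht, hC⟩
    refine ⟨Fin.cons c t, Fin.cases ⟨h₀, h₁⟩ ht, ?_⟩
    rw [image_univ_fin_succ, Fin.cons_zero]
    simp only [Fin.cons_succ]
    rw [← hC, Finset.insert_erase hc]

theorem rowSet_stripDents_erase {d o W : ℤ} {n : ℕ} {s : Fin (n + 2) → ℕ} {C : Finset ℕ} {c : ℕ}
    (hc : s 0 ≤ c) :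
    rowSet d (2 * (c + 1 : ℕ) + o) W (stripDents o (Set.range s) C) =
      rowSet d (2 * (c + 1 : ℕ) + o) W
        (stripDents o (Set.range fun i : Fin (n + 1) => s i.succ) (C.erase c)) := by
  refine rowSet_congr fun u hu _ => or_congr ?_ ?_
  · simp only [Set.exists_range_iff, Fin.exists_fin_succ (n := n + 1), or_iff_right_iff_imp]
    omega
  · refine exists_congr fun i => and_congr_left ?_
    rintro rfl
    simp only [Finset.coe_erase, Set.mem_sdiff, Set.mem_singleton_iff, iff_self_and]
    omega

open Classical in
theorem numTilings_rowSet_stripDents {d o : ℤ} {w n : ℕ} :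
    ∀ {l : ℕ} {s : Fin (n + 1) → ℕ} {C : Finset ℕ}, StrictMono s → l ≤ s 0 →
      s (Fin.last n) ≤ w → (∀ c ∈ C, l ≤ c ∧ c < w) →
      numTilings (rowSet d (2 * l + o) (2 * w + o) (stripDents o (Set.range s) C)) =
        if Interlaces C s then 1 else 0 := by
  induction n with
  | zero =>
    intro l s C _ hl hw hC
    have hrange : Set.range s = {s 0} := Set.range_unique (ι := Fin 1)
    simp only [interlaces_one_iff, hrange]
    exact numTilings_rowSet_stripDents_singleton hl hw hC
  | succ n ih =>
    intro l s C hs hl hw hC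
    have hs₁ : ∀ i ∈ Set.range s, i = s 0 ∨ s 1 ≤ i := by
      rintro _ ⟨i, rfl⟩
      exact (eq_or_ne i 0).imp (congrArg s) fun h => hs.monotone (Fin.one_le_of_ne_zero h)
    have h₀₁ : s 0 < s 1 := hs Fin.zero_lt_one
    have h₁w : s 1 ≤ w := (hs.monotone (Fin.le_last 1)).trans hw
    by_cases hlt : ∃ c ∈ C, c < s 1
    swap
    · rw [if_neg fun h => hlt h.exists_lt]
      push Not at hlt
      exact numTilings_rowSet_stripDents_eq_zero_of_lower_lower ⟨0, rfl⟩ ⟨1, rfl⟩ hl h₀₁ h₁w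
        (fun i hi => (hs₁ i hi).imp_right Or.inr) fun i hi _ => hlt i hi
    obtain ⟨c', hc', hc's⟩ := hlt
    obtain ⟨c, hc, hmin⟩ := C.exists_min_image id ⟨c', hc'⟩
    have hcs : c < s 1 := (hmin c' hc').trans_lt hc's
    obtain ⟨hlc, hcw⟩ := hC c hc
    rcases lt_or_ge c (s 0) with hcs₀ | hsc
    · rw [if_neg fun h => (h.le_of_mem hs hc).not_gt hcs₀]
      exact numTilings_rowSet_stripDents_eq_zero_of_upper_first (hlc.trans hcw.le)
        fun i hi _ _ => ⟨c, hc, hlc, (hs₁ i hi).elim (fun h => hcs₀.trans_eq h.symm) hcs.trans_le⟩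
    · rw [numTilings_rowSet_stripDents_of_lower_upper (Set.mem_range_self 0) hc hl hsc hcw
        (fun i hi _ hic => (hs₁ i hi).resolve_right (hic.trans_lt hcs).not_ge)
        fun i hi _ => hmin i hi, rowSet_stripDents_erase hsc, ih]
      · simp only [interlaces_succ_iff hs hc hsc hcs]
      · exact fun i j hij => hs (Fin.succ_lt_succ_iff.2 hij)
      · exact hcs
      · exact hw
      · intro i hi
        have hle := hmin i (Finset.mem_of_mem_erase hi)
        exact ⟨lt_of_le_of_ne hle (Finset.ne_of_mem_erase hi).symm,
          (hC i (Finset.mem_of_mem_erase hi)).2⟩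

/-! ### Trapezoids with unit dents along the base -/

/-- The abscissa of the first unit segment of the lattice line of depth `d` to the east of the
zigzag. -/
def lineOffset (d : ℕ) : ℤ := ((d + 1) % 2 : ℕ)

/-- The trapezoid with the unit triangles at the positions `X` of its base removed. -/
def dentedTrapezoid (N d : ℕ) (X : Finset ℕ) : Set UnitTriangle :=
  trapezoid N d \ dentRow (lineOffset d) (d - 1) X

/-- The number of tilings of a dented trapezoid; a trapezoid of height zero admits no dents. -/
noncomputable def numDented (N d : ℕ) (X : Finset ℕ) : ℕ :=
  if d = 0 then if X = ∅ then 1 else 0 else numTilings (dentedTrapezoid N d X)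

theorem finite_trapezoid (N m : ℤ) : (trapezoid N m).Finite := by
  refine ((Set.finite_Icc (0 : ℤ) (2 * N + m)).prod (Set.finite_Icc (0 : ℤ) m)).subset ?_
  rintro ⟨u, v⟩ ⟨h₁, h₂, h₃, h₄⟩
  simp only [Set.mem_prod, Set.mem_Icc] at *
  omega

theorem trapezoid_eq_empty {N m : ℤ} (hm : m ≤ 0) : trapezoid N m = ∅ :=
  Set.eq_empty_of_forall_notMem fun _ hp => ((hp.1.trans_lt hp.2.1).trans_le hm).false

/-- The lowest strip of the trapezoid of height `d + 1` with dents at the positions `X`, without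
the triangles covered by the lozenges that cross the line of depth `d` at the positions `C`. -/
def bottomStrip (N d : ℕ) (X C : Finset ℕ) : Set UnitTriangle :=
  rowSet d 0 (2 * N + d)
    {u | (∃ i ∈ X, u = 2 * (i : ℤ) + lineOffset (d + 1)) ∨ ∃ i ∈ C, u = 2 * (i : ℤ) + lineOffset d}

theorem dentedTrapezoid_succ_below (N d : ℕ) (X C : Finset ℕ) :
    {p ∈ dentedTrapezoid N (d + 1) X | (d : ℤ) ≤ p.2} \ dentRow (lineOffset d) d C =
      bottomStrip N d X C := by
  ext ⟨u, v⟩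
  simp only [dentedTrapezoid, trapezoid, dentRow, bottomStrip, rowSet, Set.mem_sdiff,
    Set.mem_ofPred_eq, Nat.cast_add, Nat.cast_one, add_sub_cancel_right, not_or]
  constructor
  · rintro ⟨⟨⟨h, hX⟩, hd⟩, hC⟩
    obtain rfl : v = d := by omega
    exact ⟨rfl, h.2.2.1, h.2.2.2, fun h => hX ⟨rfl, h⟩, fun h => hC ⟨rfl, h⟩⟩
  · rintro ⟨rfl, h₀, hW, hX, hC⟩
    exact ⟨⟨⟨⟨by omega, by omega, h₀, hW⟩, fun h => hX h.2⟩, le_rfl⟩, fun h => hC h.2⟩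

theorem dentedTrapezoid_succ_above (N d : ℕ) (X C : Finset ℕ) :
    {p ∈ dentedTrapezoid N (d + 1) X | p.2 < (d : ℤ)} \ dentRow (lineOffset d) (d - 1) C =
      dentedTrapezoid N d C := by
  ext ⟨u, v⟩
  simp only [dentedTrapezoid, trapezoid, dentRow, Set.mem_sdiff, Set.mem_ofPred_eq,
    Nat.cast_add, Nat.cast_one, add_sub_cancel_right]
  constructor
  · rintro ⟨⟨⟨h, -⟩, hd⟩, hC⟩
    exact ⟨⟨h.1, hd, h.2.2⟩, hC⟩
  · rintro ⟨h, hC⟩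
    exact ⟨⟨⟨⟨h.1, by omega, h.2.2⟩, fun h => by omega⟩, h.2.1⟩, hC⟩

theorem numDented_succ (N d : ℕ) (X : Finset ℕ) :
    numDented N (d + 1) X = ∑ C ∈ (Finset.range (N + (d + 1) / 2)).powerset,
      numDented N d C * numTilings (bottomStrip N d X C) := by
  have hfin : (dentedTrapezoid N (d + 1) X).Finite :=
    (finite_trapezoid _ _).subset Set.sdiff_subset
  rw [numDented, if_neg d.succ_ne_zero]
  rcases Nat.eq_zero_or_pos d with rfl | hd
  · have habove := dentedTrapezoid_succ_above N 0 X ∅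
    have hbelow := dentedTrapezoid_succ_below N 0 X ∅
    have hempty : dentedTrapezoid N 0 ∅ = ∅ := by
      rw [dentedTrapezoid, Nat.cast_zero, trapezoid_eq_empty le_rfl, Set.empty_sdiff]
    rw [hempty, Nat.cast_zero] at habove
    rw [Nat.cast_zero] at hbelow
    rw [numTilings_cut hfin 0 (lineOffset 0) ∅, Finset.powerset_empty, Finset.sum_singleton,
      habove, hbelow, numTilings_empty, Finset.sum_eq_single ∅, numDented, if_pos rfl, if_pos rfl]
    · intro C _ hC
      rw [numDented, if_pos rfl, if_neg hC, zero_mul]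
    · exact fun h => (h (Finset.empty_mem_powerset _)).elim
    · simp [dentedTrapezoid, trapezoid]
  · rw [numTilings_cut hfin d (lineOffset d) (Finset.range (N + (d + 1) / 2))]
    · refine Finset.sum_congr rfl fun C _ => ?_
      rw [dentedTrapezoid_succ_above, dentedTrapezoid_succ_below, numDented, if_neg hd.ne']
    · intro u
      simp only [dentedTrapezoid, trapezoid, dentRow, lineOffset, Set.mem_sdiff, Set.mem_ofPred_eq,
        Finset.mem_range, Int.odd_iff]
      constructor
      · rintro ⟨hu, ⟨hu', -⟩, -⟩
        exact ⟨(u / 2).toNat, by omega, by omega⟩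
      · rintro ⟨i, hi, rfl⟩
        refine ⟨by omega, ⟨by omega, by omega⟩, by omega, ?_⟩
        rintro ⟨-, j, -, h⟩
        omega

/-- The finite set of the sequences `t` with `s 0 ≤ t 0 < s 1 ≤ t 1 < s 2 ≤ ⋯ < s n`. -/
def interlacing {n : ℕ} (s : Fin (n + 1) → ℕ) : Finset (Fin n → ℕ) :=
  Fintype.piFinset fun i => Finset.Ico (s i.castSucc) (s i.succ)

theorem mem_interlacing {n : ℕ} {s : Fin (n + 1) → ℕ} {t : Fin n → ℕ} :
    t ∈ interlacing s ↔ ∀ i, s i.castSucc ≤ t i ∧ t i < s i.succ := by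
  simp only [interlacing, Fintype.mem_piFinset, Finset.mem_Ico]

theorem strictMono_of_mem_interlacing {n : ℕ} {s : Fin (n + 1) → ℕ} (hs : StrictMono s)
    {t : Fin n → ℕ} (ht : t ∈ interlacing s) : StrictMono t := by
  rw [mem_interlacing] at ht
  intro i j hij
  have : s i.succ ≤ s j.castSucc := hs.monotone (Fin.succ_le_castSucc_iff.2 hij)
  exact ((ht i).2.trans_le this).trans_le (ht j).1

open Classical in
theorem sum_powerset_mul_interlaces {n K : ℕ} {s : Fin (n + 1) → ℕ} (hs : StrictMono s)
    (hK : s (Fin.last n) ≤ K) (f : Finset ℕ → ℕ) :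
    ∑ C ∈ (Finset.range K).powerset, f C * (if Interlaces C s then 1 else 0) =
      ∑ t ∈ interlacing s, f (Finset.univ.image t) := by
  have himage : (Finset.range K).powerset.filter (fun C => Interlaces C s) =
      (interlacing s).image fun t => Finset.univ.image t := by
    ext C
    rw [Finset.mem_filter, Finset.mem_powerset]
    simp only [Finset.mem_image, mem_interlacing, Interlaces, eq_comm (a := C),
      and_iff_right_iff_imp]
    rintro ⟨t, ht, rfl⟩
    refine Finset.image_subset_iff.2 fun i _ => Finset.mem_range.2 ((ht i).2.trans_le ?_)
    exact (hs.monotone (Fin.le_last _)).trans hK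
  simp only [mul_ite, mul_one, mul_zero]
  rw [← Finset.sum_filter, himage, Finset.sum_image]
  intro t ht t' ht' h
  refine ((strictMono_of_mem_interlacing hs (Finset.mem_coe.1 ht)).range_inj
    (strictMono_of_mem_interlacing hs (Finset.mem_coe.1 ht'))).1 ?_
  simpa using congrArg (fun s : Finset ℕ => (s : Set ℕ)) h

theorem bottomStrip_even (N m : ℕ) (X C : Finset ℕ) :
    bottomStrip N (2 * m) X C =
      rowSet (2 * m : ℕ) (2 * (0 : ℕ) + 0) (2 * (N + m : ℕ) + 0) (stripDents 0 X C) := by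
  have h₀ : lineOffset (2 * m) = 0 + 1 := by unfold lineOffset; omega
  have h₁ : lineOffset (2 * m + 1) = 0 := by unfold lineOffset; omega
  have hW : (2 * (N : ℤ) + (2 * m : ℕ)) = 2 * (N + m : ℕ) + 0 := by push_cast; ring
  rw [bottomStrip, h₀, h₁, hW]
  rfl

/-- The positions `s` of the dents on a line of even depth, shifted by one, preceded by a dent at
position `0` that stands for the indentation of the zigzag. -/
def withZigzagDent {n : ℕ} (s : Fin n → ℕ) : Fin (n + 1) → ℕ := Fin.cons 0 fun i => s i + 1

@[simp]
theorem withZigzagDent_zero {n : ℕ} (s : Fin n → ℕ) : withZigzagDent s 0 = 0 := rfl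

@[simp]
theorem withZigzagDent_succ {n : ℕ} (s : Fin n → ℕ) (i : Fin n) :
    withZigzagDent s i.succ = s i + 1 := rfl

theorem strictMono_withZigzagDent {n : ℕ} {s : Fin n → ℕ} (hs : StrictMono s) :
    StrictMono (withZigzagDent s) := by
  intro i j hij
  induction j using Fin.cases with
  | zero => exact (Fin.not_lt_zero i hij).elim
  | succ j =>
    induction i using Fin.cases with
    | zero => simp
    | succ i => simpa using hs (Fin.succ_lt_succ_iff.1 hij)

theorem bottomStrip_odd (N m : ℕ) {n : ℕ} (s : Fin n → ℕ) (C : Finset ℕ) :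
    bottomStrip N (2 * m + 1) (Finset.univ.image s) C =
      rowSet (2 * m + 1 : ℕ) (2 * (0 : ℕ) + -1) (2 * (N + m + 1 : ℕ) + -1)
        (stripDents (-1) (Set.range (withZigzagDent s)) C) := by
  have h₀ : lineOffset (2 * m + 1) = -1 + 1 := by unfold lineOffset; omega
  have h₁ : lineOffset (2 * m + 1 + 1) = 1 := by unfold lineOffset; omega
  have hW : (2 * (N : ℤ) + (2 * m + 1 : ℕ)) = 2 * (N + m + 1 : ℕ) + -1 := by push_cast; ring
  rw [rowSet_eq_rowSet_add_one (a := 2 * (0 : ℕ) + -1) (Or.inl ⟨0, ⟨0, rfl⟩, rfl⟩), bottomStrip, h₀,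
    h₁, hW]
  refine rowSet_congr fun u hu _ => or_congr ?_ Iff.rfl
  simp only [Finset.mem_image, Finset.mem_univ, true_and, exists_exists_eq_and,
    Set.exists_range_iff, Fin.exists_fin_succ, withZigzagDent_zero, withZigzagDent_succ]
  rw [or_iff_right (by omega)]
  refine exists_congr fun i => ?_
  push_cast
  omega

theorem numDented_odd_empty (N m : ℕ) : numDented N (2 * m + 1) ∅ = 0 := by
  rw [numDented_succ]
  refine Finset.sum_eq_zero fun C _ => ?_
  rw [bottomStrip_even, numTilings_rowSet_stripDents_eq_zero_of_upper_first (Nat.zero_le _)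
    (by simp), mul_zero]

theorem numDented_odd_succ (N m n : ℕ) {s : Fin (n + 1) → ℕ} (hs : StrictMono s)
    (hN : ∀ i, s i < N + m + 1) :
    numDented N (2 * m + 1) (Finset.univ.image s) =
      ∑ t ∈ interlacing s, numDented N (2 * m) (Finset.univ.image t) := by
  classical
  have hw : N + (2 * m + 1) / 2 = N + m := by omega
  have hlast : s (Fin.last n) ≤ N + m := Nat.lt_succ_iff.1 (hN _)
  rw [numDented_succ, hw, ← sum_powerset_mul_interlaces hs hlast]
  refine Finset.sum_congr rfl fun C hC => ?_
  rw [bottomStrip_even, Finset.coe_image, Finset.coe_univ, Set.image_univ,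
    numTilings_rowSet_stripDents hs (Nat.zero_le _) hlast fun c hc => ⟨Nat.zero_le c, ?_⟩]
  exact Finset.mem_range.1 (Finset.mem_powerset.1 hC hc)

theorem numDented_even_succ (N m n : ℕ) {s : Fin n → ℕ} (hs : StrictMono s)
    (hN : ∀ i, s i < N + m + 1) :
    numDented N (2 * m + 2) (Finset.univ.image s) =
      ∑ t ∈ interlacing (withZigzagDent s), numDented N (2 * m + 1) (Finset.univ.image t) := by
  classical
  have hw : N + (2 * m + 1 + 1) / 2 = N + m + 1 := by omega
  have hlast : withZigzagDent s (Fin.last n) ≤ N + m + 1 :=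
    Fin.cases (motive := fun i => withZigzagDent s i ≤ N + m + 1) (Nat.zero_le _) hN _
  have hS := strictMono_withZigzagDent hs
  rw [numDented_succ, hw, ← sum_powerset_mul_interlaces hS hlast]
  refine Finset.sum_congr rfl fun C hC => ?_
  rw [bottomStrip_odd, numTilings_rowSet_stripDents hS (Nat.zero_le _) hlast
    fun c hc => ⟨Nat.zero_le c, ?_⟩]
  exact Finset.mem_range.1 (Finset.mem_powerset.1 hC hc)

/-! ### Determinants -/

theorem det_eq_det_sub_of_col_zero_eq_one {R : Type*} [CommRing R] {n : ℕ}
    (M : Matrix (Fin (n + 1)) (Fin (n + 1)) R) (hM : ∀ i, M i 0 = 1) :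
    M.det = (Matrix.of fun i j : Fin n => M i.succ j.succ - M i.castSucc j.succ).det := by
  rw [Matrix.det_eq_of_forall_row_eq_smul_add_pred (A := M)
    (B := Matrix.of fun i j => (Fin.cons (M 0 j) (fun i => M i.succ j - M i.castSucc j) :
      Fin (n + 1) → R) i) (fun _ => 1) (fun j => by simp) (fun i j => by simp),
    Matrix.det_succ_column_zero, Fin.sum_univ_succ, Finset.sum_eq_zero]
  · simp only [Matrix.of_apply, Fin.cons_zero, hM, Fin.val_zero, pow_zero, one_mul, add_zero]
    congr 1
  · intro i _
    simp [hM]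

theorem sum_Ico_sub_of_succ {R : Type*} [AddCommGroup R] {f F : ℕ → R}
    (hF : ∀ k, F (k + 1) - F k = f k) {a b : ℕ} (hab : a ≤ b) :
    ∑ k ∈ Finset.Ico a b, f k = F b - F a := by
  rw [← Finset.sum_Ico_sub F hab]
  exact Finset.sum_congr rfl fun k _ => (hF k).symm

theorem sum_piFinset_det {R : Type*} [CommRing R] {n : ℕ} (A B : Fin n → ℕ)
    (hAB : ∀ i, A i ≤ B i) (f F : Fin n → ℕ → R) (hF : ∀ j k, F j (k + 1) - F j k = f j k) :
    ∑ t ∈ Fintype.piFinset fun i => Finset.Ico (A i) (B i),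
      (Matrix.of fun i j => f j (t i)).det =
      (Matrix.of fun i j => F j (B i) - F j (A i)).det := by
  have hrows : (Matrix.of fun i j => F j (B i) - F j (A i)) =
      Matrix.of fun i => ∑ k ∈ Finset.Ico (A i) (B i), fun j => f j k := by
    ext i j
    simp only [Matrix.of_apply, Finset.sum_apply]
    rw [sum_Ico_sub_of_succ (hF j) (hAB i)]
  rw [hrows]
  exact ((Matrix.detRowAlternating (R := R) (n := Fin n)).toMultilinearMap.map_sum_finset
    (fun _ k j => f j k) fun i => Finset.Ico (A i) (B i)).symm

/-- The number of tilings of a dented trapezoid with an odd number of strips, as a determinant. -/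
def oddDet {n : ℕ} (s : Fin n → ℕ) : ℚ :=
  (Matrix.of fun i j : Fin n => ((s i + j).choose (2 * j) : ℚ)).det

/-- The number of tilings of a dented trapezoid with an even number of strips, as a determinant. -/
def evenDet {n : ℕ} (s : Fin n → ℕ) : ℚ :=
  (Matrix.of fun i j : Fin n => ((s i + 1 + j).choose (2 * j + 1) : ℚ)).det

theorem sum_evenDet {n : ℕ} {s : Fin (n + 1) → ℕ} (hs : StrictMono s) :
    ∑ t ∈ interlacing s, evenDet t = oddDet s := by
  have hpascal (j k : ℕ) : ((k + 1 + (j + 1)).choose (2 * (j + 1)) : ℚ) -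
      (k + (j + 1)).choose (2 * (j + 1)) = (k + 1 + j).choose (2 * j + 1) := by
    rw [show k + 1 + (j + 1) = k + 1 + j + 1 by ring, show 2 * (j + 1) = 2 * j + 1 + 1 by ring,
      Nat.choose_succ_succ, show k + (j + 1) = k + 1 + j by ring]
    push_cast
    ring
  unfold evenDet oddDet interlacing
  rw [sum_piFinset_det _ _ (fun i => (hs Fin.castSucc_lt_succ).le)
    (fun j k => ((k + 1 + j).choose (2 * j + 1) : ℚ))
    (fun j k => ((k + (j + 1)).choose (2 * (j + 1)) : ℚ)) fun j k => hpascal j k,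
    det_eq_det_sub_of_col_zero_eq_one _ fun i => by simp]
  simp only [Matrix.of_apply, Fin.val_succ]

theorem sum_oddDet {n : ℕ} {s : Fin n → ℕ} (hs : StrictMono s) :
    ∑ t ∈ interlacing (withZigzagDent s), oddDet t = evenDet s := by
  have hpascal (j k : ℕ) : ((k + 1 + j).choose (2 * j + 1) : ℚ) - (k + j).choose (2 * j + 1) =
      (k + j).choose (2 * j) := by
    rw [show k + 1 + j = k + j + 1 by ring, Nat.choose_succ_succ]
    push_cast
    ring
  unfold evenDet oddDet interlacing
  rw [sum_piFinset_det _ _ (fun i => (strictMono_withZigzagDent hs Fin.castSucc_lt_succ).le)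
    (fun j k => ((k + j).choose (2 * j) : ℚ))
    (fun j k => ((k + j).choose (2 * j + 1) : ℚ)) fun j k => hpascal j k]
  let M : Matrix (Fin (n + 1)) (Fin (n + 1)) ℚ := Matrix.of fun i =>
    Fin.cons 1 fun j : Fin n => ((withZigzagDent s i + j).choose (2 * j + 1) : ℚ)
  have hrow (j : Fin n) : M 0 j.succ = 0 := by
    simp only [M, Matrix.of_apply, Fin.cons_succ, withZigzagDent_zero]
    exact mod_cast Nat.choose_eq_zero_of_lt (by omega)
  have hdet := det_eq_det_sub_of_col_zero_eq_one M fun _ => rfl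
  rw [Matrix.det_succ_row_zero, Fin.sum_univ_succ, Finset.sum_eq_zero fun j _ => by simp [hrow]]
    at hdet
  simpa [M, Matrix.submatrix] using hdet.symm

theorem numDented_odd_eq_oddDet_of_even {N m : ℕ}
    (heven : ∀ {n : ℕ} {t : Fin n → ℕ}, StrictMono t → (∀ i, t i < N + m) →
      (numDented N (2 * m) (Finset.univ.image t) : ℚ) = if n = m then evenDet t else 0)
    {n : ℕ} {s : Fin n → ℕ} (hs : StrictMono s) (hN : ∀ i, s i < N + m + 1) :
    (numDented N (2 * m + 1) (Finset.univ.image s) : ℚ) = if n = m + 1 then oddDet s else 0 := by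
  cases n with
  | zero => rw [Finset.univ_eq_empty, Finset.image_empty, numDented_odd_empty, Nat.cast_zero,
      if_neg (Nat.succ_ne_zero m).symm]
  | succ n =>
    have hsum : ∀ t ∈ interlacing s,
        (numDented N (2 * m) (Finset.univ.image t) : ℚ) = if n = m then evenDet t else 0 :=
      fun t ht => heven (strictMono_of_mem_interlacing hs ht) fun i =>
        ((mem_interlacing.1 ht i).2.trans_le (Nat.lt_succ_iff.1 (hN i.succ)))
    rw [numDented_odd_succ N m n hs hN, Nat.cast_sum, Finset.sum_congr rfl hsum]
    simp only [Nat.add_right_cancel_iff]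
    split_ifs
    · exact sum_evenDet hs
    · exact Finset.sum_const_zero

theorem numDented_even_eq_evenDet {N m n : ℕ} {s : Fin n → ℕ} (hs : StrictMono s)
    (hN : ∀ i, s i < N + m) :
    (numDented N (2 * m) (Finset.univ.image s) : ℚ) = if n = m then evenDet s else 0 := by
  induction m generalizing n with
  | zero => cases n <;> simp [numDented, evenDet, Finset.univ_nonempty.ne_empty]
  | succ m ih =>
    have hS := strictMono_withZigzagDent hs
    have hsum : ∀ t ∈ interlacing (withZigzagDent s),
        (numDented N (2 * m + 1) (Finset.univ.image t) : ℚ) =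
          if n = m + 1 then oddDet t else 0 :=
      fun t ht => numDented_odd_eq_oddDet_of_even ih (strictMono_of_mem_interlacing hS ht)
        fun i => (mem_interlacing.1 ht i).2.trans_le (hN i)
    rw [show 2 * (m + 1) = 2 * m + 2 by ring, numDented_even_succ N m n hs hN, Nat.cast_sum,
      Finset.sum_congr rfl hsum]
    split_ifs
    · exact sum_oddDet hs
    · exact Finset.sum_const_zero

theorem numDented_odd_eq_oddDet {N m n : ℕ} {s : Fin n → ℕ} (hs : StrictMono s)
    (hN : ∀ i, s i < N + m + 1) :
    (numDented N (2 * m + 1) (Finset.univ.image s) : ℚ) = if n = m + 1 then oddDet s else 0 :=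
  numDented_odd_eq_oddDet_of_even numDented_even_eq_evenDet hs hN

/-! ### Product formulas -/

section Vandermonde

variable {R : Type*} [CommRing R]

/-- The Vandermonde product of the values of `f` on a finite set of positions. -/
def vand (f : ℕ → R) (X : Finset ℕ) : R := ∏ j ∈ X, ∏ i ∈ X with i < j, (f j - f i)

theorem vand_union {f : ℕ → R} {X Y : Finset ℕ} (h : ∀ i ∈ X, ∀ j ∈ Y, i < j) :
    vand f (X ∪ Y) = vand f X * vand f Y * ∏ j ∈ Y, ∏ i ∈ X, (f j - f i) := by
  have hd : Disjoint X Y := Finset.disjoint_left.2 fun i hi hj => lt_irrefl _ (h i hi i hj)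
  unfold vand
  rw [Finset.prod_union hd, mul_assoc, ← Finset.prod_mul_distrib]
  congr 1
  · refine Finset.prod_congr rfl fun j hj => Finset.prod_congr ?_ fun _ _ => rfl
    ext i
    simp only [Finset.mem_filter, Finset.mem_union]
    constructor
    · rintro ⟨hi | hi, hij⟩
      · exact ⟨hi, hij⟩
      · exact absurd hij (h j hj i hi).not_gt
    · exact fun hi => ⟨Or.inl hi.1, hi.2⟩
  · refine Finset.prod_congr rfl fun j hj => ?_
    rw [Finset.filter_union, Finset.prod_union, mul_comm,
      Finset.filter_true_of_mem fun i hi => h i hi j hj]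
    exact hd.mono (Finset.filter_subset _ _) (Finset.filter_subset _ _)

theorem vand_image {n : ℕ} {s : Fin n → ℕ} (hs : StrictMono s) (f : ℕ → R) :
    vand f (Finset.univ.image s) = ∏ i : Fin n, ∏ j ∈ Finset.Ioi i, (f (s j) - f (s i)) := by
  unfold vand
  rw [Finset.prod_image hs.injective.injOn]
  have hprod (j : Fin n) : ∏ i ∈ Finset.univ.image s with i < s j, (f (s j) - f i) =
      ∏ i ∈ Finset.Iio j, (f (s j) - f (s i)) := by
    rw [← Finset.prod_image (f := fun k => f (s j) - f k) (g := s) hs.injective.injOn]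
    refine Finset.prod_congr ?_ fun _ _ => rfl
    ext u
    simp only [Finset.mem_filter, Finset.mem_image, Finset.mem_univ, true_and, Finset.mem_Iio]
    constructor
    · rintro ⟨⟨i, rfl⟩, hi⟩
      exact ⟨i, hs.lt_iff_lt.1 hi, rfl⟩
    · rintro ⟨i, hi, rfl⟩
      exact ⟨⟨i, rfl⟩, hs hi⟩
  simp_rw [hprod]
  exact Finset.prod_comm' (by simp)

theorem det_of_prod_sub {n : ℕ} (v : Fin n → R) (r : ℕ → R) :
    (Matrix.of fun i j : Fin n => ∏ l ∈ Finset.range j, (v i - r l)).det =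
      ∏ i : Fin n, ∏ j ∈ Finset.Ioi i, (v j - v i) := by
  nontriviality R
  rw [← Matrix.det_vandermonde, Matrix.det_eval_matrixOfPolynomials_eq_det_vandermonde v
    (fun j => ∏ l ∈ Finset.range j, (Polynomial.X - Polynomial.C (r l)))]
  · simp [Polynomial.eval_prod]
  · intro i
    rw [Polynomial.natDegree_prod_of_monic _ _ fun l _ => Polynomial.monic_X_sub_C _]
    simp
  · exact fun i => Polynomial.monic_prod_of_monic _ _ fun l _ => Polynomial.monic_X_sub_C _

end Vandermonde

theorem cast_choose_succ_mul {R : Type*} [Ring R] (n k : ℕ) :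
    (n.choose (k + 1) : R) * (k + 1) = n.choose k * (n - k) := by
  rcases le_or_gt k n with hk | hk
  · rw [← Nat.cast_sub hk]
    exact_mod_cast congrArg (Nat.cast (R := R)) (Nat.choose_succ_right_eq n k)
  · rw [Nat.choose_eq_zero_of_lt hk, Nat.choose_eq_zero_of_lt (hk.trans k.lt_succ_self)]
    simp

theorem choose_two_mul_mul_factorial (a j : ℕ) :
    ((a + j).choose (2 * j) : ℚ) * (2 * j).factorial =
      ∏ l ∈ Finset.range j, ((a : ℚ) * (a + 1) - l * (l + 1)) := by
  induction j with
  | zero => simp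
  | succ j ih =>
    have habsorb : ((a + j + 1).choose (2 * j + 1 + 1) : ℚ) * (2 * j + 2) =
        (a + j + 1) * (a + j).choose (2 * j + 1) := by
      exact_mod_cast (Nat.add_one_mul_choose_eq (a + j) (2 * j + 1)).symm
    have hratio := cast_choose_succ_mul (R := ℚ) (a + j) (2 * j)
    rw [Finset.prod_range_succ, ← ih, show a + (j + 1) = a + j + 1 by ring,
      show 2 * (j + 1) = 2 * j + 1 + 1 by ring, Nat.factorial_succ, Nat.factorial_succ]
    push_cast at hratio ⊢
    linear_combination ((2 * j + 1 : ℚ) * (2 * j).factorial) * habsorb +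
      ((a + j + 1 : ℚ) * (2 * j).factorial) * hratio

theorem choose_two_mul_add_one_mul_factorial (a j : ℕ) :
    ((a + j).choose (2 * j + 1) : ℚ) * (2 * j + 1).factorial =
      a * ∏ l ∈ Finset.range j, ((a : ℚ) ^ 2 - (l + 1) ^ 2) := by
  induction j with
  | zero => simp
  | succ j ih =>
    have habsorb : ((a + j + 1).choose (2 * j + 1 + 1 + 1) : ℚ) * (2 * j + 3) =
        (a + j + 1) * (a + j).choose (2 * j + 1 + 1) := by
      exact_mod_cast (Nat.add_one_mul_choose_eq (a + j) (2 * j + 2)).symm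
    have hratio := cast_choose_succ_mul (R := ℚ) (a + j) (2 * j + 1)
    rw [Finset.prod_range_succ, ← mul_assoc, ← ih, show a + (j + 1) = a + j + 1 by ring,
      show 2 * (j + 1) + 1 = 2 * j + 1 + 1 + 1 by ring, Nat.factorial_succ,
      Nat.factorial_succ (2 * j + 1)]
    push_cast at hratio ⊢
    linear_combination ((2 * j + 2 : ℚ) * (2 * j + 1).factorial) * habsorb +
      ((a + j + 1 : ℚ) * (2 * j + 1).factorial) * hratio

theorem skipHyperfact_even (n : ℕ) :
    skipHyperfact (2 * n) = ∏ j ∈ Finset.range n, (2 * j).factorial := by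
  induction n with
  | zero => rfl
  | succ n ih =>
    rw [show 2 * (n + 1) = 2 * n + 2 by ring, skipHyperfact, ih, Finset.prod_range_succ]

theorem skipHyperfact_odd (n : ℕ) :
    skipHyperfact (2 * n + 1) = ∏ j ∈ Finset.range n, (2 * j + 1).factorial := by
  induction n with
  | zero => rfl
  | succ n ih =>
    rw [show 2 * (n + 1) + 1 = 2 * n + 1 + 2 by ring, skipHyperfact, ih, Finset.prod_range_succ]

theorem oddDet_mul_skipHyperfact {n : ℕ} {s : Fin n → ℕ} (hs : StrictMono s) :
    oddDet s * skipHyperfact (2 * n) =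
      vand (fun i => (i : ℚ) * (i + 1)) (Finset.univ.image s) := by
  rw [vand_image hs, ← det_of_prod_sub (fun i => (s i : ℚ) * (s i + 1)) fun l => (l : ℚ) * (l + 1),
    skipHyperfact_even, Nat.cast_prod, Finset.prod_range, mul_comm, oddDet,
    ← Matrix.det_mul_row]
  congr 1
  ext i j
  simp only [Matrix.of_apply]
  rw [← choose_two_mul_mul_factorial, mul_comm]

theorem evenDet_mul_skipHyperfact {n : ℕ} {s : Fin n → ℕ} (hs : StrictMono s) :
    evenDet s * skipHyperfact (2 * n + 1) = (∏ i ∈ Finset.univ.image s, ((i : ℚ) + 1)) *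
      vand (fun i => ((i : ℚ) + 1) ^ 2) (Finset.univ.image s) := by
  rw [vand_image hs, ← det_of_prod_sub (fun i => ((s i : ℚ) + 1) ^ 2) fun l => ((l : ℚ) + 1) ^ 2,
    skipHyperfact_odd, Nat.cast_prod, Finset.prod_range, mul_comm, evenDet,
    ← Matrix.det_mul_row, Finset.prod_image hs.injective.injOn, ← Matrix.det_mul_column]
  congr 1
  ext i j
  simp only [Matrix.of_apply]
  rw [mul_comm, choose_two_mul_add_one_mul_factorial]
  push_cast
  rfl

theorem exists_strictMono_image (X : Finset ℕ) :
    ∃ s : Fin X.card → ℕ, StrictMono s ∧ Finset.univ.image s = X :=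
  ⟨X.orderEmbOfFin rfl, (X.orderEmbOfFin rfl).strictMono, by simp⟩

theorem skipHyperfact_ne_zero (n : ℕ) : (skipHyperfact n : ℚ) ≠ 0 := by
  rw [Nat.cast_ne_zero]
  induction n using skipHyperfact.induct with
  | case1 => simp [skipHyperfact]
  | case2 => simp [skipHyperfact]
  | case3 n ih =>
    rw [skipHyperfact]
    exact mul_ne_zero ih (Nat.factorial_ne_zero n)

/-- The Vandermonde product of the values of `f` on a finite set of positions, with a weight `g`
for each position: the numerator of the product formulas for dented trapezoids. -/
def dentWeight (g f : ℕ → ℚ) (X : Finset ℕ) : ℚ := (∏ i ∈ X, g i) * vand f X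

/-- The weight of a set of dents for an even number of strips. -/
def evenWeight : Finset ℕ → ℚ := dentWeight (fun i => i + 1) fun i => (i + 1) ^ 2

/-- The weight of a set of dents for an odd number of strips. -/
def oddWeight : Finset ℕ → ℚ := dentWeight (fun _ => 1) fun i => i * (i + 1)

theorem numDented_odd (N m : ℕ) {X : Finset ℕ} (hX : X ⊆ Finset.range (N + m + 1)) :
    (numDented N (2 * m + 1) X : ℚ) =
      if X.card = m + 1 then oddWeight X / skipHyperfact (2 * m + 2) else 0 := by
  obtain ⟨s, hs, hsX⟩ := exists_strictMono_image X
  have hN (i : Fin X.card) : s i < N + m + 1 :=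
    Finset.mem_range.1 (hX (hsX ▸ Finset.mem_image_of_mem s (Finset.mem_univ i)))
  have hcount := numDented_odd_eq_oddDet hs hN
  have hdet := oddDet_mul_skipHyperfact hs
  rw [hsX] at hcount hdet
  rw [hcount]
  refine if_ctx_congr Iff.rfl (fun hcard => ?_) fun _ => rfl
  rw [eq_div_iff (skipHyperfact_ne_zero _), show 2 * m + 2 = 2 * X.card by omega, hdet,
    oddWeight, dentWeight, Finset.prod_const_one, one_mul]

theorem numDented_even (N m : ℕ) {X : Finset ℕ} (hX : X ⊆ Finset.range (N + m)) :
    (numDented N (2 * m) X : ℚ) =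
      if X.card = m then evenWeight X / skipHyperfact (2 * m + 1) else 0 := by
  obtain ⟨s, hs, hsX⟩ := exists_strictMono_image X
  have hN (i : Fin X.card) : s i < N + m :=
    Finset.mem_range.1 (hX (hsX ▸ Finset.mem_image_of_mem s (Finset.mem_univ i)))
  have hcount := numDented_even_eq_evenDet hs hN
  have hdet := evenDet_mul_skipHyperfact hs
  rw [hsX] at hcount hdet
  rw [hcount]
  refine if_ctx_congr Iff.rfl (fun hcard => ?_) fun _ => rfl
  rw [eq_div_iff (skipHyperfact_ne_zero _), ← hcard, hdet, evenWeight, dentWeight]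

/-! ### Triangular holes and unit dents -/

theorem numTilings_eq_numTilings_sdiff_columns (A : Finset ℤ) (d : ℤ) {S : Set UnitTriangle}
    (hS : ∀ u ∈ A,
      Odd (u + d) ∧ (u, d) ∈ S ∧ (u, d - 1) ∈ S ∧ (u - 1, d) ∉ S ∧ (u + 1, d) ∉ S) :
    numTilings S = numTilings (S \ {p | p.1 ∈ A ∧ (p.2 = d ∨ p.2 = d - 1)}) := by
  classical
  induction A using Finset.induction_on generalizing S with
  | empty => simp
  | insert a A ha ih =>
    obtain ⟨hodd, hmem, hmem', hleft, hright⟩ := hS a (Finset.mem_insert_self _ _)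
    rw [numTilings_eq_numTilings_sdiff_pair (p := (a, d)) (q := (a, d - 1)) hmem hmem', ih]
    · congr 1
      ext ⟨u, v⟩
      simp only [Set.mem_sdiff, Set.mem_insert_iff, Set.mem_singleton_iff, Prod.mk.injEq,
        Set.mem_ofPred_eq, Finset.mem_insert]
      tauto
    · intro u hu
      obtain ⟨godd, gmem, gmem', gleft, gright⟩ := hS u (Finset.mem_insert_of_mem hu)
      have hne : u ≠ a := fun h => ha (h ▸ hu)
      exact ⟨godd, ⟨gmem, by simp [hne]⟩, ⟨gmem', by simp [hne]⟩, fun h => gleft h.1,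
        fun h => gright h.1⟩
    · exact adj_iff.2 (Or.inr (Or.inr (Or.inr ⟨hodd, rfl⟩)))
    · rintro r hr hadj
      rcases adj_iff.1 hadj with rfl | rfl | ⟨h, -⟩ | ⟨-, rfl⟩
      · exact absurd hr hleft
      · exact absurd hr hright
      · exact absurd h (Int.not_even_iff_odd.2 hodd)
      · rfl

/-- The up-pointing unit triangles along the base of `upTriangle l r D`. -/
def baseRow (l r D : ℤ) : Set UnitTriangle :=
  {p | p.2 = D - 1 ∧ l < p.1 ∧ p.1 < r ∧ Odd (p.1 - l)}

theorem upTriangle_eq_union (l r D : ℤ) :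
    upTriangle l r D =
      {p ∈ upTriangle l r D | p.2 = D - 1} ∪ upTriangle (l + 1) (r - 1) (D - 1) := by
  ext ⟨u, v⟩
  simp only [upTriangle, Set.mem_union, Set.mem_ofPred_eq]
  omega

/-- Once the up-pointing triangles of the lowest row are gone, each down-pointing one must be
paired with its upper neighbour, which belongs to the base of the remaining triangle. -/
theorem numTilings_sdiff_baseRow {l r D : ℤ} {S : Set UnitTriangle} (hl : Even (l + D))
    (hr : Even (r - l)) (hS : upTriangle l r D ⊆ S) :
    numTilings (S \ baseRow l r D) =
      numTilings ((S \ {p ∈ upTriangle l r D | p.2 = D - 1}) \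
        baseRow (l + 1) (r - 1) (D - 1)) := by
  rw [Int.even_iff] at hl hr
  rw [numTilings_eq_numTilings_sdiff_columns ((Finset.Ioo l r).filter fun u => Even (u - l))
    (D - 1)]
  · rw [Set.sdiff_sdiff, Set.sdiff_sdiff]
    congr 2
    ext ⟨u, v⟩
    simp only [upTriangle, baseRow, Set.mem_union, Set.mem_ofPred_eq, Finset.mem_filter,
      Finset.mem_Ioo, Int.even_iff, Int.odd_iff]
    omega
  · intro u hu
    simp only [Finset.mem_filter, Finset.mem_Ioo, Int.even_iff] at hu
    refine ⟨by rw [Int.odd_iff]; omega, ⟨hS ?_, ?_⟩, ⟨hS ?_, ?_⟩, fun h => h.2 ?_,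
      fun h => h.2 ?_⟩ <;>
    simp only [upTriangle, baseRow, Set.mem_ofPred_eq, Int.odd_iff, true_and] <;> omega

theorem numTilings_sdiff_upTriangle (k : ℕ) {l r D : ℤ} {S : Set UnitTriangle}
    (hr : r = l + 2 * k) (hl : Even (l + D)) (hS : upTriangle l r D ⊆ S) :
    numTilings (S \ upTriangle l r D) = numTilings (S \ baseRow l r D) := by
  induction k generalizing l r D S with
  | zero =>
    congr 2
    ext ⟨u, v⟩
    simp only [upTriangle, baseRow, Set.mem_ofPred_eq]
    omega
  | succ k ih =>
    have hinner : upTriangle (l + 1) (r - 1) (D - 1) ⊆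
        S \ {p ∈ upTriangle l r D | p.2 = D - 1} := fun p hp =>
      ⟨hS (upTriangle_eq_union l r D ▸ Or.inr hp), fun hp' => (hp'.2 ▸ hp.1).false⟩
    rw [numTilings_sdiff_baseRow hl ⟨k + 1, by push_cast at hr; linarith⟩ hS,
      ← ih (by push_cast at hr; linarith) (by convert hl using 1; ring) hinner, Set.sdiff_sdiff,
      ← upTriangle_eq_union]

/-- Every second block of consecutive positions among blocks of lengths `a₁, a₂, …`, laid from
right to left and ending at the position `c`; the first block is taken iff the flag is true. -/
def altBlocks (c : ℕ) : Bool → List ℕ → Finset ℕ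
  | _, [] => ∅
  | true, k :: ks => Finset.Ico (c + ks.sum) (c + ks.sum + k) ∪ altBlocks c false ks
  | false, _ :: ks => altBlocks c true ks

/-- The triangular holes above the blocks `altBlocks`. -/
def altHoles (D l : ℤ) (c : ℕ) : Bool → List ℕ → Set UnitTriangle
  | _, [] => ∅
  | true, k :: ks => upTriangle (l + 2 * (c + ks.sum : ℕ)) (l + 2 * (c + ks.sum : ℕ) + 2 * k) D ∪
      altHoles D l c false ks
  | false, _ :: ks => altHoles D l c true ks

theorem oddSum_cons (k : ℕ) (a : List ℕ) : oddSum (k :: a) = k + evenSum a := by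
  cases a with
  | nil => rfl
  | cons b a => rfl

theorem evenSum_cons (k : ℕ) (a : List ℕ) : evenSum (k :: a) = oddSum a := rfl

theorem oddSum_add_evenSum (a : List ℕ) : oddSum a + evenSum a = a.sum := by
  induction a with
  | nil => rfl
  | cons k a ih =>
    rw [oddSum_cons, evenSum_cons, List.sum_cons, ← ih]
    ring

theorem altBlocks_subset (c : ℕ) (a : List ℕ) (b : Bool) :
    altBlocks c b a ⊆ Finset.Ico c (c + a.sum) := by
  induction a generalizing b with
  | nil => simp [altBlocks]
  | cons k a ih =>
    have hsub (b) : altBlocks c b a ⊆ Finset.Ico c (c + (k :: a).sum) :=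
      (ih b).trans (Finset.Ico_subset_Ico_right (by rw [List.sum_cons]; omega))
    cases b with
    | false => exact hsub true
    | true =>
      refine Finset.union_subset (Finset.Ico_subset_Ico (by omega) ?_) (hsub false)
      rw [List.sum_cons]
      omega

theorem disjoint_Ico_altBlocks (c k : ℕ) (a : List ℕ) (b : Bool) :
    Disjoint (Finset.Ico (c + a.sum) (c + a.sum + k)) (altBlocks c b a) :=
  (Finset.Ico_disjoint_Ico_consecutive c (c + a.sum) _).symm.mono_right (altBlocks_subset c a b)

theorem card_altBlocks (c : ℕ) (a : List ℕ) (b : Bool) :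
    (altBlocks c b a).card = if b then oddSum a else evenSum a := by
  induction a generalizing b with
  | nil => cases b <;> rfl
  | cons k a ih =>
    cases b with
    | false => exact ih true
    | true =>
      rw [altBlocks, Finset.card_union_of_disjoint (disjoint_Ico_altBlocks c k a false), ih,
        if_neg Bool.false_ne_true, if_pos rfl, oddSum_cons, Nat.card_Ico, Nat.add_sub_cancel_left]

theorem prod_altBlocks {M : Type*} [CommMonoid M] (f : ℕ → M) (c : ℕ) (a : List ℕ) :
    (∏ i ∈ altBlocks c true a, f i) * ∏ i ∈ altBlocks c false a, f i =
      ∏ i ∈ Finset.Ico c (c + a.sum), f i := by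
  induction a with
  | nil => simp [altBlocks]
  | cons k a ih =>
    rw [altBlocks, altBlocks, Finset.prod_union (disjoint_Ico_altBlocks c k a false), mul_assoc,
      mul_comm (∏ i ∈ altBlocks c false a, f i), ih, mul_comm, List.sum_cons,
      Finset.prod_Ico_consecutive f (by omega) (by omega)]
    congr 2
    ring

theorem altHoles_subset (D l : ℤ) (c : ℕ) (a : List ℕ) (b : Bool) :
    altHoles D l c b a ⊆ {p | p.2 < D ∧ l + 2 * c + (D - p.2) ≤ p.1 ∧
      p.1 ≤ l + 2 * (c + a.sum : ℕ) - (D - p.2)} := by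
  induction a generalizing b with
  | nil => simp [altHoles]
  | cons k a ih =>
    rintro ⟨u, v⟩ hp
    rw [List.sum_cons]
    cases b with
    | false =>
      have := ih true hp
      simp only [Set.mem_ofPred_eq] at *
      omega
    | true =>
      rcases hp with hp | hp
      · simp only [upTriangle, Set.mem_ofPred_eq] at *
        omega
      · have := ih false hp
        simp only [Set.mem_ofPred_eq] at *
        omega

theorem depth_le_of_mem_altHoles {D l : ℤ} {c : ℕ} {a : List ℕ} {b : Bool} {p : UnitTriangle}
    (hp : p ∈ altHoles D l c b a) : D - p.2 ≤ (if b then oddSum a else evenSum a : ℕ) := by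
  induction a generalizing b with
  | nil => cases b <;> exact hp.elim
  | cons k a ih =>
    cases b with
    | false => exact ih hp
    | true =>
      rw [if_pos rfl, oddSum_cons]
      rcases hp with hp | hp
      · simp only [upTriangle, Set.mem_ofPred_eq] at hp
        omega
      · have := ih hp
        rw [if_neg Bool.false_ne_true] at this
        omega

theorem baseRow_eq_dentRow (l D : ℤ) (c k : ℕ) :
    baseRow (l + 2 * c) (l + 2 * c + 2 * k) D = dentRow (l + 1) (D - 1) (Finset.Ico c (c + k)) := by
  ext ⟨u, v⟩
  simp only [baseRow, dentRow, Set.mem_ofPred_eq, Finset.mem_Ico, Int.odd_iff]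
  constructor
  · rintro ⟨hv, hl, hr, hodd⟩
    exact ⟨hv, ((u - l) / 2).toNat, by omega, by omega⟩
  · rintro ⟨hv, i, hi, rfl⟩
    omega

theorem numTilings_sdiff_altHoles {D l : ℤ} (hpar : Even (l + D)) (c : ℕ) (a : List ℕ) (b : Bool)
    {S : Set UnitTriangle} (hS : altHoles D l c b a ⊆ S) :
    numTilings (S \ altHoles D l c b a) =
      numTilings (S \ dentRow (l + 1) (D - 1) (altBlocks c b a)) := by
  induction a generalizing b S with
  | nil =>
    congr 2
    ext p
    simp [altHoles, altBlocks, dentRow]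
  | cons k a ih =>
    cases b with
    | false => exact ih true hS
    | true =>
    rw [altHoles] at hS ⊢
    rw [altBlocks, ← Set.sdiff_sdiff, ih, sdiff_sdiff_comm, numTilings_sdiff_upTriangle k rfl]
    · rw [Set.sdiff_sdiff, baseRow_eq_dentRow, dentRow_union, Set.union_comm]
    · rw [Int.even_iff] at *
      omega
    · rintro ⟨u, v⟩ hp
      refine ⟨hS (Or.inl hp), ?_⟩
      rintro ⟨hv, i, hi, hu⟩
      have := Finset.mem_Ico.1 (altBlocks_subset c a false hi)
      simp only [upTriangle, Set.mem_ofPred_eq] at *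
      omega
    · intro p hp
      refine ⟨hS (Or.inr hp), fun hp' => ?_⟩
      have := altHoles_subset D l c a false hp
      simp only [upTriangle, Set.mem_ofPred_eq] at *
      omega

theorem numTilings_trapezoid_altHoles (N d c : ℕ) (a : List ℕ) {X : Finset ℕ}
    (hX : X ⊆ Finset.range c) (hd : oddSum a ≤ d) (hd₀ : d ≠ 0)
    (hN : 2 * ((c + a.sum : ℕ) : ℤ) + lineOffset d - 1 = 2 * N + d) :
    numTilings ((trapezoid N d \ altHoles d (lineOffset d - 1) c true a) \
      dentRow (lineOffset d) (d - 1) X) = numDented N d (X ∪ altBlocks c true a) := by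
  rw [numDented, if_neg hd₀, dentedTrapezoid, sdiff_sdiff_comm, numTilings_sdiff_altHoles,
    Set.sdiff_sdiff, dentRow_union, sub_add_cancel]
  · unfold lineOffset
    rw [Int.even_iff]
    omega
  · rintro ⟨u, v⟩ hp
    have habscissa := altHoles_subset _ _ _ _ _ hp
    have hdepth := depth_le_of_mem_altHoles hp
    have hoffset : 0 ≤ lineOffset d := by unfold lineOffset; omega
    simp only [Set.mem_ofPred_eq, if_true] at habscissa hdepth
    refine ⟨?_, ?_⟩
    · simp only [trapezoid, Set.mem_ofPred_eq]
      omega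
    · rintro ⟨hv, i, hi, hu⟩
      have := Finset.mem_range.1 (hX hi)
      simp only at hv hu
      omega

/-! ### Quartered hexagons as dented trapezoids -/

theorem revPrefix_cons (k : ℕ) (a : List ℕ) (m : ℕ) :
    revPrefix (k :: a) (m + 1) = revPrefix a m ++ [k] := by
  induction m with
  | zero => rfl
  | succ m ih =>
    rw [revPrefix, ih, revPrefix]
    rfl

theorem length_revPrefix (a : List ℕ) (m : ℕ) : (revPrefix a m).length = m := by
  induction m with
  | zero => rfl
  | succ m ih => rw [revPrefix, List.length_cons, ih]

theorem sum_revPrefix {a : List ℕ} {m : ℕ} (hm : a.length ≤ m) :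
    (revPrefix a m).sum = a.sum := by
  induction a generalizing m with
  | nil =>
    induction m with
    | zero => rfl
    | succ m ih => simpa [revPrefix] using ih (Nat.zero_le _)
  | cons k a ih =>
    obtain ⟨m, rfl⟩ := Nat.exists_eq_add_one_of_ne_zero (Nat.ne_zero_of_lt hm)
    rw [revPrefix_cons, List.sum_append, ih (Nat.le_of_succ_le_succ hm), List.sum_cons,
      List.sum_cons, List.sum_nil, add_zero, add_comm]

theorem addHead_append (c : ℕ) {L : List ℕ} (hL : L ≠ []) (L' : List ℕ) :
    addHead c (L ++ L') = addHead c L ++ L' := by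
  cases L with
  | nil => exact absurd rfl hL
  | cons t L => rfl

theorem sum_addHead (c : ℕ) {L : List ℕ} (hL : L ≠ []) : (addHead c L).sum = c + L.sum := by
  cases L with
  | nil => exact absurd rfl hL
  | cons t L => simp [addHead, add_assoc]

theorem length_addHead (c : ℕ) (L : List ℕ) : (addHead c L).length = L.length := by
  cases L <;> rfl

theorem baseHoles_append (D : ℤ) (g k : ℕ) : ∀ (L : List ℕ) (l : ℤ), Even L.length →
    baseHoles D l (L ++ [g, k]) = baseHoles D l L ∪
      upTriangle (l + 2 * (L.sum + g : ℕ)) (l + 2 * (L.sum + g : ℕ) + 2 * k) D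
  | [], _, _ => by simp [baseHoles]
  | [_], _, h => by simp at h
  | t :: t' :: ts, l, h => by
    have hts : Even ts.length := by simpa [Nat.even_add_one] using h
    have hshift : l + 2 * (t : ℤ) + 2 * (t' : ℤ) + 2 * (ts.sum + g : ℕ) =
        l + 2 * ((t :: t' :: ts).sum + g : ℕ) := by
      simp only [List.sum_cons]
      push_cast
      ring
    simp only [List.cons_append, baseHoles]
    rw [baseHoles_append D g k ts _ hts, Set.union_assoc, hshift]

theorem evenSum_append (g k : ℕ) : ∀ L : List ℕ, Even L.length →
    evenSum (L ++ [g, k]) = evenSum L + k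
  | [], _ => by simp [evenSum, oddSum]
  | [_], h => by simp at h
  | t :: t' :: ts, h => by
    have hts : Even ts.length := by simpa [Nat.even_add_one] using h
    simp only [List.cons_append, oddSum_cons, evenSum_cons, evenSum_append g k ts hts]
    omega

/-- The sequence `(c + a₂ₘ, a₂ₘ₋₁, …, a₁)` with `m = ⌈n / 2⌉`. -/
def quarterSeq (c : ℕ) (a : List ℕ) : List ℕ :=
  addHead c (revPrefix a (2 * ((a.length + 1) / 2)))

theorem even_length_quarterSeq (c : ℕ) (a : List ℕ) : Even (quarterSeq c a).length := by
  rw [quarterSeq, length_addHead, length_revPrefix]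
  simp

theorem quarterSeq_cons_cons (c k k' k'' : ℕ) (a : List ℕ) :
    quarterSeq c (k :: k' :: k'' :: a) = quarterSeq c (k'' :: a) ++ [k', k] := by
  unfold quarterSeq
  have hlength : 2 * (((k :: k' :: k'' :: a).length + 1) / 2) =
      2 * (((k'' :: a).length + 1) / 2) + 1 + 1 := by
    simp only [List.length_cons]
    omega
  rw [hlength, revPrefix_cons, revPrefix_cons, List.append_assoc, addHead_append]
  · rfl
  · rw [← List.length_pos_iff, length_revPrefix]
    simp only [List.length_cons]
    omega

theorem sum_quarterSeq (c k : ℕ) (a : List ℕ) :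
    (quarterSeq c (k :: a)).sum = c + (k :: a).sum := by
  rw [quarterSeq, sum_addHead, sum_revPrefix]
  · simp only [List.length_cons]
    omega
  · rw [← List.length_pos_iff, length_revPrefix]
    simp only [List.length_cons]
    omega

theorem baseHoles_quarterSeq (D l : ℤ) (c : ℕ) : ∀ a : List ℕ,
    baseHoles D l (quarterSeq c a) = altHoles D l c true a
  | [] => rfl
  | [k] => by simp [quarterSeq, revPrefix, addHead, baseHoles, altHoles]
  | [k, k'] => by simp [quarterSeq, revPrefix, addHead, baseHoles, altHoles]
  | k :: k' :: k'' :: a => by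
    rw [quarterSeq_cons_cons, baseHoles_append _ _ _ _ _ (even_length_quarterSeq _ _),
      baseHoles_quarterSeq D l c (k'' :: a), sum_quarterSeq, Set.union_comm]
    simp only [altHoles, List.sum_cons]
    rw [show c + (k'' + a.sum) + k' = c + (k' + (k'' + a.sum)) by ring]

theorem evenSum_quarterSeq (c : ℕ) : ∀ a : List ℕ, evenSum (quarterSeq c a) = oddSum a
  | [] => rfl
  | [k] => by simp [quarterSeq, revPrefix, addHead, evenSum, oddSum]
  | [k, k'] => by simp [quarterSeq, revPrefix, addHead, evenSum, oddSum]
  | k :: k' :: k'' :: a => by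
    rw [quarterSeq_cons_cons, evenSum_append _ _ _ (even_length_quarterSeq _ _),
      evenSum_quarterSeq c (k'' :: a), oddSum_cons k, evenSum_cons, add_comm]

theorem oddSum_quarterSeq (c k : ℕ) (a : List ℕ) :
    oddSum (quarterSeq c (k :: a)) = c + evenSum (k :: a) := by
  have hquarter := oddSum_add_evenSum (quarterSeq c (k :: a))
  have hsum := oddSum_add_evenSum (k :: a)
  rw [evenSum_quarterSeq, sum_quarterSeq] at hquarter
  omega

theorem altBlocks_eq_empty {c : ℕ} {a : List ℕ} (ha : oddSum a = 0) :
    altBlocks c true a = ∅ := by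
  rw [← Finset.card_eq_zero, card_altBlocks, if_pos rfl, ha]

theorem dentRow_empty (o d : ℤ) : dentRow o d ∅ = ∅ := by simp [dentRow]

theorem numQ_quarterSeq (c : ℕ) (a : List ℕ) :
    numQ (quarterSeq c a) = numDented (c + evenSum a) (2 * oddSum a) (altBlocks c true a) := by
  unfold numQ regionQ
  rw [evenSum_quarterSeq]
  rcases Nat.eq_zero_or_pos (oddSum a) with ha | ha
  · rw [altBlocks_eq_empty ha, ha, trapezoid_eq_empty (by simp), Set.empty_sdiff, numTilings_empty]
    simp [numDented]
  · obtain ⟨k, a, rfl⟩ := List.exists_cons_of_ne_nil (show a ≠ [] by rintro rfl; exact ha.false)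
    have hsum := oddSum_add_evenSum (k :: a)
    have hoffset : lineOffset (2 * oddSum (k :: a)) = 1 := by unfold lineOffset; omega
    have hdents := numTilings_trapezoid_altHoles (c + evenSum (k :: a)) (2 * oddSum (k :: a)) c
      (k :: a) (Finset.empty_subset _) (by omega) (by omega)
      (by rw [hoffset, ← hsum]; push_cast; ring)
    rw [Finset.empty_union, dentRow_empty, Set.sdiff_empty] at hdents
    rw [← hdents, oddSum_quarterSeq, baseHoles_quarterSeq, hoffset]
    simp

theorem numK_quarterSeq (c : ℕ) {a : List ℕ} (ha : 0 < oddSum a) :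
    numK (quarterSeq c a) = numDented (c + evenSum a) (2 * oddSum a - 1) (altBlocks c true a) := by
  obtain ⟨k, a, rfl⟩ := List.exists_cons_of_ne_nil (show a ≠ [] by rintro rfl; exact ha.false)
  unfold numK regionK
  rw [evenSum_quarterSeq]
  have hsum := oddSum_add_evenSum (k :: a)
  have hoffset : lineOffset (2 * oddSum (k :: a) - 1) = 0 := by unfold lineOffset; omega
  have hheight : ((2 * oddSum (k :: a) - 1 : ℕ) : ℤ) = 2 * (oddSum (k :: a) : ℕ) - 1 := by omega
  have hdents := numTilings_trapezoid_altHoles (c + evenSum (k :: a)) (2 * oddSum (k :: a) - 1) c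
    (k :: a) (Finset.empty_subset _) (by omega) (by omega)
    (by rw [hoffset, ← hsum, hheight]; push_cast; ring)
  rw [Finset.empty_union, dentRow_empty, Set.sdiff_empty] at hdents
  rw [← hdents, oddSum_quarterSeq, baseHoles_quarterSeq, hoffset, hheight]
  simp

theorem numK_quarterSeq_of_oddSum_eq_zero (c : ℕ) {a : List ℕ} (ha : oddSum a = 0) :
    numK (quarterSeq c a) = 1 := by
  unfold numK regionK
  rw [evenSum_quarterSeq, ha, trapezoid_eq_empty (by simp), Set.empty_sdiff, numTilings_empty]

theorem quarterSeq_cons (c z : ℕ) (a : List ℕ) :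
    quarterSeq c (z :: a) = addHead c (revPrefix a (2 * (a.length / 2) + 1)) ++ [z] := by
  unfold quarterSeq
  have hlength : 2 * (((z :: a).length + 1) / 2) = 2 * (a.length / 2) + 1 + 1 := by
    simp only [List.length_cons]
    omega
  rw [hlength, revPrefix_cons, addHead_append]
  rw [← List.length_pos_iff, length_revPrefix]
  omega

/-! ### Cutting the halved hexagon along the line of the removed triangles -/

theorem mem_fern_iff_of_lt {D l : ℤ} {c : ℕ} {a : List ℕ} {b : Bool} {p : UnitTriangle}
    (hp : p.2 < D) :
    p ∈ fern D b (l + 2 * (c + a.sum : ℕ)) a ↔ p ∈ altHoles D l c b a := by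
  induction a generalizing b with
  | nil => cases b <;> rfl
  | cons k a ih =>
    have hr : l + 2 * (c + (k :: a).sum : ℕ) = l + 2 * (c + a.sum : ℕ) + 2 * k := by
      rw [List.sum_cons]
      push_cast
      ring
    rw [hr]
    cases b with
    | false =>
      rw [fern, altHoles, Set.mem_union, add_sub_cancel_right, ih, or_iff_right]
      simp only [downTriangle, Set.mem_ofPred_eq]
      omega
    | true => rw [fern, altHoles, Set.mem_union, Set.mem_union, add_sub_cancel_right, ih]

theorem reflect_mem_fern_iff_of_lt {D D' l : ℤ} {c : ℕ} {a : List ℕ} {b : Bool}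
    {p : UnitTriangle} (hp : p.2 < D') :
    (p.1, D + D' - 1 - p.2) ∈ fern D b (l + 2 * (c + a.sum : ℕ)) a ↔
      p ∈ altHoles D' l c (!b) a := by
  induction a generalizing b with
  | nil => cases b <;> rfl
  | cons k a ih =>
    have hr : l + 2 * (c + (k :: a).sum : ℕ) = l + 2 * (c + a.sum : ℕ) + 2 * k := by
      rw [List.sum_cons]
      push_cast
      ring
    rw [hr]
    cases b with
    | false =>
      rw [Bool.not_false, fern, altHoles, Set.mem_union, Set.mem_union, add_sub_cancel_right, ih,
        Bool.not_true]
      refine or_congr_left ?_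
      simp only [downTriangle, upTriangle, Set.mem_ofPred_eq]
      omega
    | true =>
      rw [Bool.not_true, fern, altHoles, Set.mem_union, add_sub_cancel_right, ih, or_iff_right,
        Bool.not_false]
      simp only [upTriangle, Set.mem_ofPred_eq]
      omega

theorem lt_of_mem_fern {D r : ℤ} {a : List ℕ} {b : Bool} {p : UnitTriangle}
    (hp : p ∈ fern D b r a) : r - 2 * a.sum < p.1 := by
  induction a generalizing b r with
  | nil => cases b <;> exact hp.elim
  | cons k a ih =>
    rw [List.sum_cons]
    cases b <;> rcases hp with hp | hp
    case false.inl | true.inl =>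
      simp only [downTriangle, upTriangle, Set.mem_ofPred_eq] at hp
      omega
    case false.inr | true.inr =>
      have := ih hp
      omega

theorem mem_fern_or_mem_fern {D r u : ℤ} {a : List ℕ} {b : Bool} (hpar : Odd (r - u))
    (hleft : r - 2 * a.sum < u) (hright : u < r) :
    (u, D - 1) ∈ fern D b r a ∨ (u, D) ∈ fern D b r a := by
  induction a generalizing b r with
  | nil =>
    simp only [List.sum_nil] at hleft
    omega
  | cons k a ih =>
    rw [List.sum_cons, Nat.cast_add] at hleft
    rw [Int.odd_iff] at hpar
    by_cases hu : u < r - 2 * k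
    · have hrest (b) : (u, D - 1) ∈ fern D b (r - 2 * k) a ∨ (u, D) ∈ fern D b (r - 2 * k) a :=
        ih (by rw [Int.odd_iff]; omega) (by omega) hu
      cases b
      case false => exact (hrest true).imp Or.inr Or.inr
      case true => exact (hrest false).imp Or.inr Or.inr
    · cases b
      case false =>
        refine Or.inr (Or.inl ?_)
        simp only [downTriangle, Set.mem_ofPred_eq]
        omega
      case true =>
        refine Or.inl (Or.inl ?_)
        simp only [upTriangle, Set.mem_ofPred_eq]
        omega

theorem finite_halvedHexagon (N A B : ℤ) : (halvedHexagon N A B).Finite :=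
  (finite_trapezoid N (A + B)).subset fun _ hp => ⟨hp.1, hp.2.1, hp.2.2.1, hp.2.2.2.1⟩

section Cut

variable {x y z D D' : ℕ} {a : List ℕ}

theorem regionR_eq (hD : D + 1 = y + 2 * oddSum a) :
    regionR x y z a =
      halvedHexagon (x + evenSum a) (y + z + 2 * oddSum a - 1) (y + z + 2 * evenSum a - 1) \
        fern D true (lineOffset D - 1 + 2 * (x + y / 2 + a.sum : ℕ)) a := by
  have hsum := oddSum_add_evenSum a
  have hdepth : (y : ℤ) + 2 * oddSum a - 1 = D := by omega
  have hright : (2 * (x + evenSum a) + D : ℤ) =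
      lineOffset D - 1 + 2 * (x + y / 2 + a.sum : ℕ) := by
    unfold lineOffset
    omega
  rw [regionR, hdepth, hright]

theorem regionR_above (hD : D + 1 = y + 2 * oddSum a) (hB : 1 ≤ y + 2 * z + 2 * evenSum a) :
    {p ∈ regionR x y z a | p.2 < (D : ℤ)} = trapezoid ((x + evenSum a : ℕ) : ℤ) D \
      altHoles D (lineOffset D - 1) (x + y / 2) true a := by
  ext ⟨u, v⟩
  rw [regionR_eq hD]
  simp only [halvedHexagon, trapezoid, Set.mem_sdiff, Set.mem_ofPred_eq]
  constructor
  · rintro ⟨⟨hhex, hfern⟩, hv⟩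
    exact ⟨by omega, fun h => hfern ((mem_fern_iff_of_lt hv).2 h)⟩
  · rintro ⟨htrap, hholes⟩
    have hv : v < D := htrap.2.1
    exact ⟨⟨by omega, fun h => hholes ((mem_fern_iff_of_lt hv).1 h)⟩, hv⟩

theorem regionR_below (hD : D + 1 = y + 2 * oddSum a)
    (hD' : D' + 1 = y + 2 * z + 2 * evenSum a) :
    {p : UnitTriangle | (p.1, (D : ℤ) + D' - 1 - p.2) ∈ {p ∈ regionR x y z a | (D : ℤ) ≤ p.2}} =
      trapezoid ((x + oddSum a : ℕ) : ℤ) D' \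
        altHoles D' (lineOffset D - 1) (x + y / 2) true (z :: a) := by
  have hsum := oddSum_add_evenSum a
  have hright : lineOffset D - 1 + 2 * (x + y / 2 + a.sum : ℕ) =
      (2 * (x + evenSum a) + D : ℤ) := by
    unfold lineOffset
    omega
  ext ⟨u, v⟩
  rw [regionR_eq hD]
  simp only [halvedHexagon, trapezoid, altHoles, Set.mem_sdiff, Set.mem_union,
    Set.mem_ofPred_eq, not_or]
  have hfern (hv : v < D') := reflect_mem_fern_iff_of_lt (D := D) (D' := D') (a := a) (b := true)
    (l := lineOffset D - 1) (c := x + y / 2) (p := (u, v)) hv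
  rw [upTriangle, Set.mem_ofPred_eq, hright] at *
  constructor
  · rintro ⟨⟨hhex, h⟩, hv⟩
    exact ⟨by omega, by omega, fun h' => h ((hfern (by omega)).2 h')⟩
  · rintro ⟨htrap, htriangle, h⟩
    have hv : v < D' := htrap.2.1
    exact ⟨⟨by omega, fun h' => h ((hfern hv).1 h')⟩, by omega⟩

theorem numTilings_regionR_above (hD : D + 1 = y + 2 * oddSum a)
    (hB : 1 ≤ y + 2 * z + 2 * evenSum a) {X : Finset ℕ} (hX : X ⊆ Finset.range (x + y / 2))
    (hX₀ : D = 0 → X = ∅) :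
    numTilings ({p ∈ regionR x y z a | p.2 < (D : ℤ)} \ dentRow (lineOffset D) (D - 1) X) =
      numDented (x + evenSum a) D (X ∪ altBlocks (x + y / 2) true a) := by
  have hsum := oddSum_add_evenSum a
  rw [regionR_above hD hB]
  rcases Nat.eq_zero_or_pos D with h₀ | h₀
  · rw [hX₀ h₀, altBlocks_eq_empty (by omega), trapezoid_eq_empty (by omega), Set.empty_sdiff,
      Set.empty_sdiff, numTilings_empty]
    simp [numDented, h₀]
  · refine numTilings_trapezoid_altHoles _ _ _ _ hX (by omega) h₀.ne' ?_
    unfold lineOffset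
    omega

theorem numTilings_regionR_below (hD : D + 1 = y + 2 * oddSum a)
    (hD' : D' + 1 = y + 2 * z + 2 * evenSum a) {X : Finset ℕ}
    (hX : X ⊆ Finset.range (x + y / 2)) (hX₀ : D' = 0 → X = ∅) :
    numTilings ({p ∈ regionR x y z a | (D : ℤ) ≤ p.2} \ dentRow (lineOffset D) D X) =
      numDented (x + oddSum a) D' (X ∪ altBlocks (x + y / 2) true (z :: a)) := by
  have hsum := oddSum_add_evenSum a
  have hoffset : lineOffset D' = lineOffset D := by
    unfold lineOffset
    omega
  have hreflect : {p : UnitTriangle | (p.1, (D : ℤ) + D' - 1 - p.2) ∈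
      {p ∈ regionR x y z a | (D : ℤ) ≤ p.2} \ dentRow (lineOffset D) D X} =
      (trapezoid ((x + oddSum a : ℕ) : ℤ) D' \
        altHoles D' (lineOffset D' - 1) (x + y / 2) true (z :: a)) \
        dentRow (lineOffset D') (D' - 1) X := by
    rw [hoffset, ← regionR_below hD hD']
    ext ⟨u, v⟩
    simp only [Set.mem_sdiff, Set.mem_ofPred_eq, dentRow]
    refine and_congr_right fun _ => not_congr (and_congr_left fun _ => ?_)
    omega
  rw [← numTilings_reflect _ (c := (D : ℤ) + D' - 1) (by rw [Int.odd_iff]; omega), hreflect]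
  rcases Nat.eq_zero_or_pos D' with h₀ | h₀
  · rw [hX₀ h₀, altBlocks_eq_empty (by rw [oddSum_cons]; omega), trapezoid_eq_empty (by omega),
      Set.empty_sdiff, Set.empty_sdiff, numTilings_empty]
    simp [numDented, h₀]
  · refine numTilings_trapezoid_altHoles _ _ _ _ hX (by rw [oddSum_cons]; omega) h₀.ne' ?_
    unfold lineOffset
    rw [List.sum_cons]
    omega

theorem crossing_mem_regionR_iff (hD : D + 1 = y + 2 * oddSum a)
    (hD' : D' + 1 = y + 2 * z + 2 * evenSum a) (hD₀ : D ≠ 0) (hD₀' : D' ≠ 0) (u : ℤ) :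
    (Odd (u + D) ∧ (u, (D : ℤ) - 1) ∈ regionR x y z a ∧ (u, (D : ℤ)) ∈ regionR x y z a) ↔
      ∃ i ∈ Finset.range (x + y / 2), u = 2 * (i : ℤ) + lineOffset D := by
  have hsum := oddSum_add_evenSum a
  have hoffset : lineOffset D = ((D + 1) % 2 : ℕ) := rfl
  rw [regionR_eq hD]
  simp only [halvedHexagon, Set.mem_sdiff, Set.mem_ofPred_eq, Finset.mem_range]
  rw [Int.odd_iff]
  constructor
  · rintro ⟨hpar, ⟨hhex, habove⟩, -, hbelow⟩
    refine ⟨((u - lineOffset D) / 2).toNat, ?_, by omega⟩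
    by_contra hlt
    refine (mem_fern_or_mem_fern ?_ ?_ ?_).elim habove hbelow
    · rw [Int.odd_iff]
      omega
    · omega
    · omega
  · rintro ⟨i, hi, rfl⟩
    have hwest {v : ℤ} : (2 * (i : ℤ) + lineOffset D, v) ∉
        fern D true (lineOffset D - 1 + 2 * (x + y / 2 + a.sum : ℕ)) a := fun h => by
      have := lt_of_mem_fern h
      simp only at this
      omega
    exact ⟨by omega, ⟨by omega, hwest⟩, by omega, hwest⟩

theorem numTilings_regionR (hD : D + 1 = y + 2 * oddSum a)
    (hD' : D' + 1 = y + 2 * z + 2 * evenSum a) :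
    numTilings (regionR x y z a) = ∑ X ∈ (Finset.range (x + y / 2)).powerset,
      numDented (x + evenSum a) D (X ∪ altBlocks (x + y / 2) true a) *
        numDented (x + oddSum a) D' (X ∪ altBlocks (x + y / 2) true (z :: a)) := by
  have hB : 1 ≤ y + 2 * z + 2 * evenSum a := by omega
  have hfin : (regionR x y z a).Finite := (finite_halvedHexagon _ _ _).subset Set.sdiff_subset
  by_cases h₀ : D = 0 ∨ D' = 0
  · have hempty (X : Finset ℕ) (hX : X ≠ ∅) (Y : Finset ℕ) : X ∪ Y ≠ ∅ :=
      fun h => hX (Finset.union_eq_empty.1 h).1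
    rw [numTilings_cut hfin D (lineOffset D) ∅, Finset.powerset_empty, Finset.sum_singleton,
      Finset.sum_eq_single ∅,
      numTilings_regionR_above hD hB (Finset.empty_subset _) fun _ => rfl,
      numTilings_regionR_below hD hD' (Finset.empty_subset _) fun _ => rfl]
    · intro X _ hX
      rcases h₀ with h₀ | h₀
      · rw [numDented, if_pos h₀, if_neg (hempty X hX _), zero_mul]
      · rw [numDented.eq_1 _ D', if_pos h₀, if_neg (hempty X hX _), mul_zero]
    · exact fun h => (h (Finset.empty_mem_powerset _)).elim
    · intro u
      simp only [Finset.notMem_empty, false_and, exists_false, iff_false, regionR, halvedHexagon,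
        Set.mem_sdiff, Set.mem_ofPred_eq]
      omega
  · rw [not_or] at h₀
    rw [numTilings_cut hfin D (lineOffset D) (Finset.range (x + y / 2))
      (crossing_mem_regionR_iff hD hD' h₀.1 h₀.2)]
    refine Finset.sum_congr rfl fun X hX => ?_
    rw [Finset.mem_powerset] at hX
    rw [numTilings_regionR_above hD hB hX (absurd · h₀.1),
      numTilings_regionR_below hD hD' hX (absurd · h₀.2)]

end Cut

/-! ### The sum over the crossing lozenges -/

theorem dentWeight_empty (g f : ℕ → ℚ) : dentWeight g f ∅ = 1 := by simp [dentWeight, vand]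

theorem dentWeight_union {g f : ℕ → ℚ} {X Y : Finset ℕ} (h : ∀ i ∈ X, ∀ j ∈ Y, i < j) :
    dentWeight g f (X ∪ Y) =
      dentWeight g f X * dentWeight g f Y * ∏ j ∈ Y, ∏ i ∈ X, (f j - f i) := by
  have hd : Disjoint X Y := Finset.disjoint_left.2 fun i hi hj => lt_irrefl _ (h i hi i hj)
  rw [dentWeight, dentWeight, dentWeight, vand_union h, Finset.prod_union hd]
  ring

/-- The part of the sum over the lozenges crossing the line that does not depend on the
arrangement of the removed triangles: `k` lozenges occupy some of the first `m` positions, and the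
next `w` positions are covered by removed triangles of either orientation. -/
def crossingSum (g f : ℕ → ℚ) (k m w : ℕ) : ℚ :=
  ∑ X ∈ (Finset.range m).powerset, if X.card = k then
    dentWeight g f X ^ 2 * ∏ j ∈ Finset.Ico m (m + w), ∏ i ∈ X, (f j - f i) else 0

theorem crossingSum_zero (g f : ℕ → ℚ) (m w : ℕ) : crossingSum g f 0 m w = 1 := by
  rw [crossingSum, Finset.sum_eq_single ∅]
  · simp [dentWeight_empty]
  · intro X _ hX
    rw [if_neg (by rwa [Finset.card_eq_zero])]
  · simp

theorem lt_of_mem_altBlocks {c : ℕ} {X : Finset ℕ} (hX : X ⊆ Finset.range c) (a : List ℕ) :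
    ∀ i ∈ X, ∀ j ∈ altBlocks c true a, i < j := fun _ hi _ hj =>
  (Finset.mem_range.1 (hX hi)).trans_le (Finset.mem_Ico.1 (altBlocks_subset c a true hj)).1

theorem card_union_altBlocks {c : ℕ} {X : Finset ℕ} (hX : X ⊆ Finset.range c) (a : List ℕ) :
    (X ∪ altBlocks c true a).card = X.card + oddSum a := by
  rw [Finset.card_union_of_disjoint, card_altBlocks, if_pos rfl]
  exact Finset.disjoint_left.2 fun i hi hj => lt_irrefl i (lt_of_mem_altBlocks hX a i hi i hj)

theorem altBlocks_subset_range (c : ℕ) (a : List ℕ) :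
    altBlocks c true a ⊆ Finset.range (c + a.sum) :=
  fun _ hi => Finset.mem_range.2 (Finset.mem_Ico.1 (altBlocks_subset c a true hi)).2

theorem union_altBlocks_subset_range {c : ℕ} {X : Finset ℕ} (hX : X ⊆ Finset.range c)
    (a : List ℕ) : X ∪ altBlocks c true a ⊆ Finset.range (c + a.sum) :=
  Finset.union_subset (hX.trans (Finset.range_mono (Nat.le_add_right _ _)))
    (altBlocks_subset_range c a)

/-- The blocks of `a` and those of `z :: a` partition the positions to the east of `X`, so that the
mixed factors of the two weights combine into a product over all these positions. -/
theorem dentWeight_mul_dentWeight_cons (g f : ℕ → ℚ) {m : ℕ} {X : Finset ℕ}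
    (hX : X ⊆ Finset.range m) (z : ℕ) (a : List ℕ) :
    dentWeight g f (X ∪ altBlocks m true a) * dentWeight g f (X ∪ altBlocks m true (z :: a)) =
      dentWeight g f (altBlocks m true a) * dentWeight g f (altBlocks m true (z :: a)) *
        (dentWeight g f X ^ 2 *
          ∏ j ∈ Finset.Ico m (m + (a.sum + z)), ∏ i ∈ X, (f j - f i)) := by
  have hmixed := prod_altBlocks (fun j => ∏ i ∈ X, (f j - f i)) m (z :: a)
  rw [List.sum_cons, add_comm z, mul_comm] at hmixed
  rw [dentWeight_union (lt_of_mem_altBlocks hX a),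
    dentWeight_union (lt_of_mem_altBlocks hX (z :: a)), ← hmixed]
  change _ = _ * (_ * ((∏ i ∈ altBlocks m true a, _) * _))
  ring

theorem sum_mul_eq_crossingSum (g f : ℕ → ℚ) (k m z : ℕ) (a : List ℕ) {c₁ c₂ : ℚ}
    {F₁ F₂ : Finset ℕ → ℕ}
    (hF₁ : ∀ X ⊆ Finset.range m, (F₁ (X ∪ altBlocks m true a) : ℚ) = if X.card = k then
      dentWeight g f (X ∪ altBlocks m true a) / c₁ else 0)
    (hF₂ : ∀ X ⊆ Finset.range m, (F₂ (X ∪ altBlocks m true (z :: a)) : ℚ) = if X.card = k then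
      dentWeight g f (X ∪ altBlocks m true (z :: a)) / c₂ else 0) :
    ((∑ X ∈ (Finset.range m).powerset,
      F₁ (X ∪ altBlocks m true a) * F₂ (X ∪ altBlocks m true (z :: a)) : ℕ) : ℚ) =
      dentWeight g f (altBlocks m true a) * dentWeight g f (altBlocks m true (z :: a)) / (c₁ * c₂) *
        crossingSum g f k m (a.sum + z) := by
  rw [Nat.cast_sum, crossingSum, Finset.mul_sum]
  refine Finset.sum_congr rfl fun X hX => ?_
  rw [Finset.mem_powerset] at hX
  rw [Nat.cast_mul, hF₁ X hX, hF₂ X hX]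
  split_ifs
  · rw [div_mul_div_comm, dentWeight_mul_dentWeight_cons g f hX, mul_div_right_comm]
  · rw [mul_zero, mul_zero]

theorem numTilings_regionR_two_mul_add_one (x k z : ℕ) (a : List ℕ) :
    (numTilings (regionR x (2 * k + 1) z a) : ℚ) =
      evenWeight (altBlocks (x + k) true a) * evenWeight (altBlocks (x + k) true (z :: a)) /
        (skipHyperfact (2 * oddSum a + (2 * k + 1)) *
          skipHyperfact (2 * evenSum a + (2 * k + 1) + 2 * z)) *
        crossingSum (fun i => i + 1) (fun i => (i + 1) ^ 2) k (x + k) (a.sum + z) := by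
  have hsum := oddSum_add_evenSum a
  rw [numTilings_regionR (D := 2 * (k + oddSum a)) (D' := 2 * (k + (z + evenSum a))) (by ring)
    (by ring), show (2 * k + 1) / 2 = k by omega]
  refine sum_mul_eq_crossingSum _ _ k (x + k) z a (fun X hX => ?_) fun X hX => ?_
  · rw [numDented_even, card_union_altBlocks hX,
      show 2 * (k + oddSum a) + 1 = 2 * oddSum a + (2 * k + 1) by ring]
    · exact if_congr Nat.add_right_cancel_iff rfl rfl
    · exact (union_altBlocks_subset_range hX a).trans (Finset.range_mono (by omega))
  · rw [numDented_even, card_union_altBlocks hX, oddSum_cons,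
      show 2 * (k + (z + evenSum a)) + 1 = 2 * evenSum a + (2 * k + 1) + 2 * z by ring]
    · exact if_congr Nat.add_right_cancel_iff rfl rfl
    · refine (union_altBlocks_subset_range hX (z :: a)).trans (Finset.range_mono ?_)
      rw [List.sum_cons]
      omega

theorem numTilings_regionR_two_mul (x : ℕ) {k z : ℕ} {a : List ℕ} (habove : 0 < k + oddSum a)
    (hbelow : 0 < k + z + evenSum a) :
    (numTilings (regionR x (2 * k) z a) : ℚ) =
      oddWeight (altBlocks (x + k) true a) * oddWeight (altBlocks (x + k) true (z :: a)) /
        (skipHyperfact (2 * oddSum a + 2 * k) * skipHyperfact (2 * evenSum a + 2 * k + 2 * z)) *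
        crossingSum (fun _ => 1) (fun i => i * (i + 1)) k (x + k) (a.sum + z) := by
  have hsum := oddSum_add_evenSum a
  obtain ⟨m, hm⟩ := Nat.exists_eq_add_one.2 habove
  obtain ⟨m', hm'⟩ := Nat.exists_eq_add_one.2 hbelow
  rw [numTilings_regionR (D := 2 * m + 1) (D' := 2 * m' + 1) (by omega) (by omega),
    show 2 * k / 2 = k by omega]
  refine sum_mul_eq_crossingSum _ _ k (x + k) z a (fun X hX => ?_) fun X hX => ?_
  · rw [numDented_odd, card_union_altBlocks hX, ← hm,
      show 2 * m + 2 = 2 * oddSum a + 2 * k by omega]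
    · exact if_congr Nat.add_right_cancel_iff rfl rfl
    · exact (union_altBlocks_subset_range hX a).trans (Finset.range_mono (by omega))
  · rw [numDented_odd, card_union_altBlocks hX, oddSum_cons, ← hm', add_assoc k,
      show 2 * m' + 2 = 2 * evenSum a + 2 * k + 2 * z by omega]
    · exact if_congr Nat.add_right_cancel_iff rfl rfl
    · refine (union_altBlocks_subset_range hX (z :: a)).trans (Finset.range_mono ?_)
      rw [List.sum_cons]
      omega

theorem numQ_quarterSeq_eq (c : ℕ) (a : List ℕ) :
    (numQ (quarterSeq c a) : ℚ) =
      evenWeight (altBlocks c true a) / skipHyperfact (2 * oddSum a + 1) := by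
  have hsum := oddSum_add_evenSum a
  rw [numQ_quarterSeq, numDented_even, if_pos ((card_altBlocks c a true).trans (if_pos rfl))]
  exact (altBlocks_subset_range c a).trans (Finset.range_mono (by omega))

theorem numK_quarterSeq_eq (c : ℕ) (a : List ℕ) :
    (numK (quarterSeq c a) : ℚ) =
      oddWeight (altBlocks c true a) / skipHyperfact (2 * oddSum a) := by
  have hsum := oddSum_add_evenSum a
  rcases Nat.eq_zero_or_pos (oddSum a) with hzero | hpos
  · rw [numK_quarterSeq_of_oddSum_eq_zero c hzero, altBlocks_eq_empty hzero, hzero, oddWeight,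
      dentWeight_empty]
    simp [skipHyperfact]
  · obtain ⟨m, hm⟩ := Nat.exists_eq_add_one.2 hpos
    rw [numK_quarterSeq c hpos, show 2 * oddSum a - 1 = 2 * m + 1 by omega, numDented_odd,
      if_pos ((card_altBlocks c a true).trans hm), hm, mul_add_one]
    exact (altBlocks_subset_range c a).trans (Finset.range_mono (by omega))

/-! ### Weights of intervals -/

theorem dentWeight_Ico_succ (g f : ℕ → ℚ) (x n : ℕ) :
    dentWeight g f (Finset.Ico x (x + (n + 1))) = dentWeight g f (Finset.Ico x (x + n)) *
      g (x + n) * ∏ t ∈ Finset.range n, (f (x + n) - f (x + t)) := by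
  rw [← add_assoc, ← Finset.Ico_union_Ico_eq_Ico (Nat.le_add_right x n) (Nat.le_succ (x + n)),
    Nat.Ico_succ_singleton, dentWeight_union (by simp)]
  simp [dentWeight, vand, Finset.filter_singleton, Finset.prod_Ico_eq_prod_range]

theorem prod_range_sub_eq_factorial {R : Type*} [CommRing R] (n : ℕ) :
    ∏ t ∈ Finset.range n, ((n : R) - t) = n.factorial := by
  rw [Finset.prod_range_natCast_sub, ← Nat.descFactorial_eq_prod_range, Nat.descFactorial_self]

theorem evenWeight_Ico_succ (x n : ℕ) :
    evenWeight (Finset.Ico x (x + (n + 1))) = evenWeight (Finset.Ico x (x + n)) *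
      (x + n + 1) * (n.factorial * (2 * x + n + 2).ascFactorial n) := by
  rw [evenWeight, dentWeight_Ico_succ, Nat.ascFactorial_eq_prod_range, Nat.cast_prod,
    ← prod_range_sub_eq_factorial, ← Finset.prod_mul_distrib]
  push_cast
  congr 1
  exact Finset.prod_congr rfl fun t _ => by ring

theorem oddWeight_Ico_succ (x n : ℕ) :
    oddWeight (Finset.Ico x (x + (n + 1))) = oddWeight (Finset.Ico x (x + n)) *
      (n.factorial * (2 * x + n + 1).ascFactorial n) := by
  rw [oddWeight, dentWeight_Ico_succ, Nat.ascFactorial_eq_prod_range, Nat.cast_prod,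
    ← prod_range_sub_eq_factorial, ← Finset.prod_mul_distrib, mul_one]
  push_cast
  congr 1
  exact Finset.prod_congr rfl fun t _ => by ring

theorem evenWeight_Ico_zero (x : ℕ) : evenWeight (Finset.Ico x (x + 0)) = 1 := by
  simp [evenWeight, dentWeight_empty]

theorem oddWeight_Ico_zero (x : ℕ) : oddWeight (Finset.Ico x (x + 0)) = 1 := by
  simp [oddWeight, dentWeight_empty]

theorem evenWeight_Ico_pos (x n : ℕ) : 0 < evenWeight (Finset.Ico x (x + n)) := by
  induction n with
  | zero => rw [evenWeight_Ico_zero]; exact one_pos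
  | succ n ih => rw [evenWeight_Ico_succ]; positivity

theorem oddWeight_Ico_pos (x n : ℕ) : 0 < oddWeight (Finset.Ico x (x + n)) := by
  induction n with
  | zero => rw [oddWeight_Ico_zero]; exact one_pos
  | succ n ih => rw [oddWeight_Ico_succ]; positivity

theorem cast_ascFactorial_succ {R : Type*} [CommSemiring R] (n k : ℕ) :
    (n.ascFactorial (k + 1) : R) = (n + k) * n.ascFactorial k := by
  rw [Nat.ascFactorial_succ]
  push_cast
  rfl

theorem cast_factorial_succ {R : Type*} [Semiring R] (n : ℕ) :
    ((n + 1).factorial : R) = (n + 1) * n.factorial := by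
  rw [Nat.factorial_succ]
  push_cast
  rfl

theorem evenWeight_Ico_add_two (x n : ℕ) :
    evenWeight (Finset.Ico x (x + (n + 2))) * 4 = evenWeight (Finset.Ico (x + 1) (x + 1 + n)) *
      (n.factorial * (n + 1).factorial) * (2 * x + 2).ascFactorial (2 * n + 3) := by
  induction n with
  | zero =>
    rw [show 0 + 2 = 0 + 1 + 1 by rfl, evenWeight_Ico_succ, evenWeight_Ico_succ,
      evenWeight_Ico_zero, evenWeight_Ico_zero]
    simp only [cast_ascFactorial_succ, Nat.ascFactorial_zero, mul_zero, zero_add, Nat.factorial]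
    push_cast
    ring
  | succ n ih =>
    rw [show n + 1 + 2 = (n + 2) + 1 by ring, evenWeight_Ico_succ, evenWeight_Ico_succ (x + 1) n,
      show 2 * x + (n + 2) + 2 = 2 * x + n + 4 by ring,
      show 2 * (x + 1) + n + 2 = 2 * x + n + 4 by ring,
      show 2 * (n + 1) + 3 = 2 * n + 3 + 1 + 1 by ring]
    simp only [cast_ascFactorial_succ, cast_factorial_succ] at ih ⊢
    push_cast at ih ⊢
    linear_combination ((x + n + 3 : ℚ) * ((n + 1 + 1) * ((n + 1) * n.factorial) *
      ((2 * x + n + 4 + (n + 1)) * ((2 * x + n + 4 + n) *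
        ((2 * x + n + 4).ascFactorial n : ℚ))))) * ih

theorem evenWeight_Ico_succ_eq_oddWeight (x n : ℕ) :
    evenWeight (Finset.Ico x (x + (n + 1))) * 2 ^ (n + 1) =
      oddWeight (Finset.Ico (x + 1) (x + 1 + n)) * n.factorial *
        (2 * x + 2).ascFactorial (2 * n + 1) := by
  induction n with
  | zero =>
    rw [evenWeight_Ico_succ, evenWeight_Ico_zero, oddWeight_Ico_zero]
    simp only [cast_ascFactorial_succ, Nat.ascFactorial_zero, mul_zero, zero_add, Nat.factorial]
    push_cast
    ring
  | succ n ih =>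
    rw [evenWeight_Ico_succ, oddWeight_Ico_succ (x + 1) n,
      show 2 * x + (n + 1) + 2 = 2 * x + n + 3 by ring,
      show 2 * (x + 1) + n + 1 = 2 * x + n + 3 by ring,
      show 2 * (n + 1) + 1 = 2 * n + 1 + 1 + 1 by ring]
    simp only [cast_ascFactorial_succ, cast_factorial_succ] at ih ⊢
    push_cast at ih ⊢
    linear_combination (2 * (x + n + 2 : ℚ) * ((n + 1) * n.factorial) *
      ((2 * x + n + 3 + n) * ((2 * x + n + 3).ascFactorial n : ℚ))) * ih

theorem oddWeight_Ico_succ_eq_evenWeight (x n : ℕ) :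
    oddWeight (Finset.Ico x (x + (n + 1))) =
      evenWeight (Finset.Ico x (x + n)) * (2 ^ n * n.factorial) := by
  induction n with
  | zero =>
    rw [oddWeight_Ico_succ, evenWeight_Ico_zero, oddWeight_Ico_zero]
    simp
  | succ n ih =>
    rw [oddWeight_Ico_succ, ih, evenWeight_Ico_succ,
      show 2 * x + (n + 1) + 1 = 2 * x + n + 2 by ring]
    simp only [cast_ascFactorial_succ, cast_factorial_succ]
    push_cast
    ring

theorem skipHyperfact_add_two (n : ℕ) :
    skipHyperfact (n + 2) = skipHyperfact n * n.factorial := rfl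

theorem skipHyperfact_two_mul_add_two (n : ℕ) :
    skipHyperfact (2 * n + 2) = skipHyperfact (2 * n + 1) * (2 ^ n * n.factorial) := by
  induction n with
  | zero => rfl
  | succ n ih =>
    rw [mul_add_one, skipHyperfact_add_two (2 * n + 2), add_right_comm (2 * n) 2 1,
      skipHyperfact_add_two (2 * n + 1), ih, Nat.factorial_succ (2 * n + 1), Nat.factorial_succ n]
    ring

theorem prod_Icc_one_succ {M : Type*} [CommMonoid M] (f : ℕ → M) (k : ℕ) :
    ∏ i ∈ Finset.Icc 1 (k + 1), f i = f 1 * ∏ i ∈ Finset.Icc 1 k, f (i + 1) := by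
  induction k with
  | zero => simp
  | succ k ih =>
    rw [Finset.prod_Icc_succ_top (by omega), ih, Finset.prod_Icc_succ_top (by omega), mul_assoc]

theorem hyperfact_succ (n : ℕ) : hyperfact (n + 1) = hyperfact n * n.factorial :=
  Finset.prod_range_succ _ _

theorem hyperfact_ne_zero (n : ℕ) : (hyperfact n : ℚ) ≠ 0 :=
  Nat.cast_ne_zero.2 (Finset.prod_ne_zero_iff.2 fun k _ => k.factorial_ne_zero)

theorem prod_ascFactorial_succ (x k m : ℕ) :
    ∏ i ∈ Finset.Icc 1 (k + 1), ((2 * x + 2 * i).ascFactorial (m + 4 - 4 * i) : ℚ) =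
      (2 * x + 2).ascFactorial m *
        ∏ i ∈ Finset.Icc 1 k, ((2 * (x + 1) + 2 * i).ascFactorial (m - 4 * i) : ℚ) := by
  rw [prod_Icc_one_succ, mul_one, mul_one, Nat.add_sub_cancel]
  congr 1
  refine Finset.prod_congr rfl fun i _ => ?_
  rw [show 2 * x + 2 * (i + 1) = 2 * (x + 1) + 2 * i by ring,
    show m + 4 - 4 * (i + 1) = m - 4 * i by omega]

theorem evenWeight_Ico_add_two_mul (x k w : ℕ) :
    evenWeight (Finset.Ico x (x + (w + 2 * k))) * 2 ^ (2 * k) * hyperfact w =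
      evenWeight (Finset.Ico (x + k) (x + k + w)) * hyperfact (w + 2 * k) *
        ∏ i ∈ Finset.Icc 1 k, ((2 * x + 2 * i).ascFactorial (2 * w + 4 * k + 3 - 4 * i) : ℚ) := by
  induction k generalizing x with
  | zero => simp
  | succ k ih =>
    have hpeel := evenWeight_Ico_add_two x (w + 2 * k)
    have hrest := ih (x + 1)
    rw [show x + 1 + k = x + (k + 1) by ring,
      show 2 * w + 4 * k + 3 = 2 * (w + 2 * k) + 3 by ring] at hrest
    rw [show 2 * w + 4 * (k + 1) + 3 = 2 * (w + 2 * k) + 3 + 4 by ring, prod_ascFactorial_succ,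
      mul_add_one, ← add_assoc w, hyperfact_succ (w + 2 * k + 1), hyperfact_succ (w + 2 * k),
      pow_add]
    push_cast
    linear_combination (2 ^ (2 * k) * (hyperfact w : ℚ)) * hpeel +
      (((w + 2 * k).factorial : ℚ) * (w + 2 * k + 1).factorial *
        (2 * x + 2).ascFactorial (2 * (w + 2 * k) + 3)) * hrest

theorem evenWeight_Ico_add_two_mul_add_one (x k w : ℕ) :
    evenWeight (Finset.Ico x (x + (w + 2 * k + 1))) *
        (2 ^ (w + 2 * k + 1) * (w + 2 * k + 1).factorial) * hyperfact w =
      oddWeight (Finset.Ico (x + (k + 1)) (x + (k + 1) + w)) * hyperfact (w + 2 * k + 2) *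
        ∏ i ∈ Finset.Icc 1 (k + 1),
          ((2 * x + 2 * i).ascFactorial (2 * w + 4 * (k + 1) + 1 - 4 * i) : ℚ) := by
  induction k generalizing x with
  | zero =>
    have hpeel := evenWeight_Ico_succ_eq_oddWeight x w
    simp only [mul_zero, add_zero, zero_add, Finset.Icc_self, Finset.prod_singleton]
    rw [hyperfact_succ (w + 1), hyperfact_succ w,
      show 2 * w + 4 * 1 + 1 - 4 * 1 = 2 * w + 1 by omega, mul_one]
    push_cast
    linear_combination (((w + 1).factorial : ℚ) * hyperfact w) * hpeel
  | succ k ih =>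
    have hpeel := evenWeight_Ico_add_two x (w + 2 * k + 1)
    have hrest := ih (x + 1)
    rw [show x + 1 + (k + 1) = x + (k + 1 + 1) by ring,
      show 2 * w + 4 * (k + 1) + 1 = 2 * (w + 2 * k + 1) + 3 by ring] at hrest
    rw [show 2 * w + 4 * (k + 1 + 1) + 1 = 2 * (w + 2 * k + 1) + 3 + 4 by ring,
      prod_ascFactorial_succ, show w + 2 * (k + 1) = w + 2 * k + 2 by ring,
      hyperfact_succ (w + 2 * k + 2 + 1), hyperfact_succ (w + 2 * k + 2),
      show 2 ^ (w + 2 * k + 2 + 1) = (2 : ℚ) ^ (w + 2 * k + 1) * 4 by ring]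
    push_cast
    linear_combination (2 ^ (w + 2 * k + 1) * ((w + 2 * k + 2 + 1).factorial : ℚ) *
      (hyperfact w : ℚ)) * hpeel + (((w + 2 * k + 2).factorial : ℚ) *
        (w + 2 * k + 2 + 1).factorial *
        (2 * x + 2).ascFactorial (2 * (w + 2 * k + 1) + 3)) * hrest

/-! ### The tiling formula -/

theorem altBlocks_singleton (c k : ℕ) : altBlocks c true [k] = Finset.Ico c (c + k) := by
  simp [altBlocks]

theorem quarterSeq_singleton (c k : ℕ) : quarterSeq c [k] = [c, k] := by
  simp [quarterSeq, revPrefix, addHead]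

theorem regionR_nil (x : ℕ) {n y z : ℕ} (h : y + z = n + 1) :
    regionR x y z [] = regionQ (quarterSeq x [n]) := by
  ext ⟨u, v⟩
  simp only [regionR, regionQ, quarterSeq_singleton, halvedHexagon, trapezoid, baseHoles, fern,
    upTriangle, oddSum, evenSum, List.tail, Set.mem_sdiff, Set.mem_ofPred_eq, Set.mem_union,
    Set.mem_empty_iff_false, not_false_eq_true, and_true, or_false]
  push_cast
  omega

theorem regionR_zero_zero_singleton (x n : ℕ) :
    regionR x 0 0 [n + 1] = regionQ (quarterSeq x [n]) := by
  ext ⟨u, v⟩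
  simp only [regionR, regionQ, quarterSeq_singleton, halvedHexagon, trapezoid, baseHoles, fern,
    upTriangle, oddSum, evenSum, List.tail, Set.mem_sdiff, Set.mem_ofPred_eq, Set.mem_union,
    Set.mem_empty_iff_false, or_false]
  push_cast
  omega

theorem numTilings_regionR_nil (x : ℕ) {n y z : ℕ} (h : y + z = n + 1) :
    (numTilings (regionR x y z []) : ℚ) =
      evenWeight (Finset.Ico x (x + n)) / skipHyperfact (2 * n + 1) := by
  rw [regionR_nil x h, ← numQ, numQ_quarterSeq_eq, altBlocks_singleton]
  rfl

theorem crossingSum_evenWeight (x k w : ℕ) :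
    crossingSum (fun i => i + 1) (fun i => (i + 1) ^ 2) k (x + k) w =
      (∏ i ∈ Finset.Icc 1 k, ((2 * x + 2 * i).ascFactorial (2 * w + 4 * k + 3 - 4 * i) : ℚ)) *
        (1 / 2 ^ (2 * k)) * (hyperfact (w + 2 * k) * skipHyperfact (2 * k + 1) *
          skipHyperfact (2 * k + 1 + 2 * w) /
          (hyperfact w * skipHyperfact (2 * (w + 2 * k) + 1))) := by
  have hcount := numTilings_regionR_two_mul_add_one x k w []
  rw [numTilings_regionR_nil x (n := w + 2 * k) (by ring), altBlocks_singleton] at hcount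
  have hweight := evenWeight_Ico_add_two_mul x k w
  have hempty : evenWeight (altBlocks (x + k) true []) = 1 := dentWeight_empty _ _
  have hpos := evenWeight_Ico_pos (x + k) w
  have hhyper := hyperfact_ne_zero w
  have hskip := skipHyperfact_ne_zero
  simp only [hempty, oddSum, evenSum, List.tail_nil, List.sum_nil, mul_zero, zero_add, one_mul]
    at hcount
  rw [div_eq_iff (hskip _)] at hcount
  rw [hcount] at hweight
  refine mul_left_cancel₀ hpos.ne' ?_
  field_simp [hskip] at hweight ⊢
  linear_combination hweight

theorem crossingSum_oddWeight (x k w : ℕ) :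
    crossingSum (fun _ => 1) (fun i => i * (i + 1)) k (x + k) w =
      (∏ i ∈ Finset.Icc 1 k, ((2 * x + 2 * i).ascFactorial (2 * w + 4 * k + 1 - 4 * i) : ℚ)) *
        (hyperfact (w + 2 * k) * skipHyperfact (2 * k) * skipHyperfact (2 * k + 2 * w) /
          (hyperfact w * skipHyperfact (2 * w + 4 * k))) := by
  have hhyper := hyperfact_ne_zero w
  have hskip := skipHyperfact_ne_zero
  cases k with
  | zero => simp [crossingSum_zero, skipHyperfact, hhyper, hskip]
  | succ k =>
    have hcount :=
      numTilings_regionR_two_mul x (k := k + 1) (z := w) (a := []) (by omega) (by omega)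
    rw [numTilings_regionR_nil x (n := w + 2 * k + 1) (by ring), altBlocks_singleton] at hcount
    have hweight := evenWeight_Ico_add_two_mul_add_one x k w
    have hempty : oddWeight (altBlocks (x + (k + 1)) true []) = 1 := dentWeight_empty _ _
    have hpos := oddWeight_Ico_pos (x + (k + 1)) w
    have hlast := skipHyperfact_two_mul_add_two (w + 2 * k + 1)
    rw [show 2 * (w + 2 * k + 1) + 2 = 2 * w + 4 * (k + 1) by ring] at hlast
    simp only [hempty, oddSum, evenSum, List.tail_nil, List.sum_nil, mul_zero, zero_add, one_mul]
      at hcount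
    rw [div_eq_iff (hskip _)] at hcount
    rw [hcount] at hweight
    rw [show w + 2 * (k + 1) = w + 2 * k + 2 by ring, hlast, Nat.cast_mul, Nat.cast_mul]
    refine mul_left_cancel₀ hpos.ne' ?_
    generalize crossingSum _ _ _ _ _ = T at hweight ⊢
    generalize (∏ _ ∈ _, _ : ℚ) = P at hweight ⊢
    push_cast
    field_simp [hskip] at hweight ⊢
    linear_combination hweight

theorem numQ_quarterSeq_singleton_eq_numK (x n : ℕ) :
    numQ (quarterSeq x [n]) = numK (quarterSeq x [n + 1]) := by
  have hskip := skipHyperfact_ne_zero (2 * n + 1)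
  have hfact : (n.factorial : ℚ) ≠ 0 := Nat.cast_ne_zero.2 n.factorial_ne_zero
  have hQ := numQ_quarterSeq_eq x [n]
  have hK := numK_quarterSeq_eq x [n + 1]
  simp only [altBlocks_singleton, oddSum] at hQ hK
  rw [oddWeight_Ico_succ_eq_evenWeight, mul_add_one, skipHyperfact_two_mul_add_two] at hK
  rw [← Nat.cast_inj (R := ℚ), hQ, hK]
  push_cast
  field_simp

theorem numTilings_regionR_zero_zero_singleton (x : ℕ) {n : ℕ} (hn : 0 < n) :
    numTilings (regionR x 0 0 [n]) = numK (quarterSeq x [n]) := by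
  obtain ⟨n, rfl⟩ := Nat.exists_eq_add_one.2 hn
  rw [regionR_zero_zero_singleton, ← numQ_quarterSeq_singleton_eq_numK, numQ]

/-- The weights of the fixed dents enter the tiling number with the normalisations `c₁`, `c₂` of the
two parts of the halved hexagon, and the numbers of tilings of the quartered hexagons with the
normalisations `e₁`, `e₂`. -/
theorem mul_prefactor_eq {c₁ c₂ e₁ e₂ t s : ℚ} (W₁ W₂ P h s₁ s₂ : ℚ) (hc₁ : c₁ ≠ 0) (hc₂ : c₂ ≠ 0)
    (he₁ : e₁ ≠ 0) (he₂ : e₂ ≠ 0) (ht : t ≠ 0) (hs : s ≠ 0) :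
    W₁ * W₂ / (c₁ * c₂) * (P * (h * s₁ * s₂ / (t * s))) =
      P * (h * s₁ * e₂ * e₁ * s₂ / (t * c₂ * c₁ * s)) * (W₁ / e₁) * (W₂ / e₂) := by
  field_simp

theorem numTilings_regionR_two_mul_add_one_eq (x k z : ℕ) (a : List ℕ) :
    (numTilings (regionR x (2 * k + 1) z a) : ℚ) =
      (∏ i ∈ Finset.Icc 1 k,
        ((2 * x + 2 * i).ascFactorial (2 * (a.sum + z) + 4 * k + 3 - 4 * i) : ℚ)) *
      (1 / 2 ^ (2 * k)) *
      ((hyperfact (a.sum + z + 2 * k) * skipHyperfact (2 * k + 1) *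
          skipHyperfact (2 * evenSum a + 2 * z + 1) * skipHyperfact (2 * oddSum a + 1) *
          skipHyperfact (2 * k + 1 + 2 * (a.sum + z))) /
        (hyperfact (a.sum + z) * skipHyperfact (2 * evenSum a + (2 * k + 1) + 2 * z) *
          skipHyperfact (2 * oddSum a + (2 * k + 1)) *
          skipHyperfact (2 * (a.sum + z + 2 * k) + 1))) *
      numQ (quarterSeq (x + k) a) * numQ (quarterSeq (x + k) (z :: a)) := by
  rw [numTilings_regionR_two_mul_add_one, crossingSum_evenWeight, numQ_quarterSeq_eq,
    numQ_quarterSeq_eq, oddSum_cons, mul_add 2 z, add_comm (2 * z)]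
  exact mul_prefactor_eq _ _ _ _ _ _ (skipHyperfact_ne_zero _) (skipHyperfact_ne_zero _)
    (skipHyperfact_ne_zero _) (skipHyperfact_ne_zero _) (hyperfact_ne_zero _)
    (skipHyperfact_ne_zero _)

theorem exists_eq_singleton_of_evenSum_eq_zero {a : List ℕ} (ha : ∀ j ∈ a, 0 < j)
    (hodd : 0 < oddSum a) (heven : evenSum a = 0) : ∃ n, 0 < n ∧ a = [n] := by
  match a with
  | [] => simp [oddSum] at hodd
  | [n] => exact ⟨n, ha n (by simp), rfl⟩
  | _ :: m :: b =>
    have hm := ha m (by simp)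
    rw [evenSum_cons, oddSum_cons] at heven
    omega

theorem numTilings_regionR_two_mul_eq (x : ℕ) {k z : ℕ} {a : List ℕ} (ha : ∀ j ∈ a, 0 < j)
    (habove : 0 < k + oddSum a) :
    (numTilings (regionR x (2 * k) z a) : ℚ) =
      (∏ i ∈ Finset.Icc 1 k,
        ((2 * x + 2 * i).ascFactorial (2 * (a.sum + z) + 4 * k + 1 - 4 * i) : ℚ)) *
      ((hyperfact (a.sum + z + 2 * k) * skipHyperfact (2 * k) *
          skipHyperfact (2 * evenSum a + 2 * z) * skipHyperfact (2 * oddSum a) *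
          skipHyperfact (2 * k + 2 * (a.sum + z))) /
        (hyperfact (a.sum + z) * skipHyperfact (2 * evenSum a + 2 * k + 2 * z) *
          skipHyperfact (2 * oddSum a + 2 * k) *
          skipHyperfact (2 * (a.sum + z) + 4 * k))) *
      numK (quarterSeq (x + k) a) * numK (quarterSeq (x + k) (z :: a)) := by
  rcases Nat.eq_zero_or_pos (k + z + evenSum a) with hdegenerate | hbelow
  · obtain ⟨rfl, rfl, heven⟩ : k = 0 ∧ z = 0 ∧ evenSum a = 0 := by omega
    obtain ⟨n, hn, rfl⟩ :=
      exists_eq_singleton_of_evenSum_eq_zero ha (by rwa [zero_add] at habove) heven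
    have hK : numK (quarterSeq (x + 0) [0, n]) = 1 := numK_quarterSeq_of_oddSum_eq_zero _ rfl
    rw [hK, mul_zero, numTilings_regionR_zero_zero_singleton x hn]
    have hskip := skipHyperfact_ne_zero (2 * n)
    have hhyper := hyperfact_ne_zero n
    simp only [oddSum, evenSum, List.tail_cons, List.sum_singleton, skipHyperfact, mul_zero,
      add_zero, zero_add, Finset.Icc_eq_empty_of_lt zero_lt_one, Finset.prod_empty, Nat.cast_one,
      mul_one, one_mul]
    field_simp
  · rw [numTilings_regionR_two_mul x habove hbelow, crossingSum_oddWeight, numK_quarterSeq_eq,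
      numK_quarterSeq_eq, oddSum_cons, mul_add 2 z, add_comm (2 * z)]
    exact mul_prefactor_eq _ _ _ _ _ _ (skipHyperfact_ne_zero _) (skipHyperfact_ne_zero _)
      (skipHyperfact_ne_zero _) (skipHyperfact_ne_zero _) (hyperfact_ne_zero _)
      (skipHyperfact_ne_zero _)

end HalvedHexagon

open HalvedHexagon in
theorem mainTheorem1 (x y z : ℕ) (a : List ℕ) (ha : ∀ k ∈ a, 0 < k)
    (hy : a.getD 0 0 + 1 ≤ y + 2 * oddSum a) :
    (Odd y →
      (numTilings (regionR x y z a) : ℚ) =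
        (∏ i ∈ Finset.Icc 1 ((y - 1) / 2),
          ((2 * x + 2 * i).ascFactorial (2 * a.sum + 2 * y + 2 * z + 1 - 4 * i) : ℚ)) *
        (1 / 2 ^ (y - 1)) *
        ((hyperfact (a.sum + y + z - 1) * skipHyperfact y *
            skipHyperfact (2 * evenSum a + 2 * z + 1) * skipHyperfact (2 * oddSum a + 1) *
            skipHyperfact (2 * a.sum + y + 2 * z)) /
          (hyperfact (a.sum + z) * skipHyperfact (2 * evenSum a + y + 2 * z) *
            skipHyperfact (2 * oddSum a + y) *
            skipHyperfact (2 * a.sum + 2 * y + 2 * z - 1))) *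
        numQ (addHead (x + (y - 1) / 2) (revPrefix a (2 * ((a.length + 1) / 2)))) *
        numQ (addHead (x + (y - 1) / 2) (revPrefix a (2 * (a.length / 2) + 1)) ++ [z])) ∧
    (Even y →
      (numTilings (regionR x y z a) : ℚ) =
        (∏ i ∈ Finset.Icc 1 (y / 2),
          ((2 * x + 2 * i).ascFactorial (2 * a.sum + 2 * y + 2 * z + 1 - 4 * i) : ℚ)) *
        ((hyperfact (a.sum + y + z) * skipHyperfact y *
            skipHyperfact (2 * evenSum a + 2 * z) * skipHyperfact (2 * oddSum a) *
            skipHyperfact (2 * a.sum + y + 2 * z)) /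
          (hyperfact (a.sum + z) * skipHyperfact (2 * evenSum a + y + 2 * z) *
            skipHyperfact (2 * oddSum a + y) *
            skipHyperfact (2 * a.sum + 2 * y + 2 * z))) *
        numK (addHead (x + y / 2) (revPrefix a (2 * ((a.length + 1) / 2)))) *
        numK (addHead (x + y / 2) (revPrefix a (2 * (a.length / 2) + 1)) ++ [z])) := by
  rw [← quarterSeq_cons, ← quarterSeq_cons, ← quarterSeq, ← quarterSeq]
  constructor
  · rintro ⟨k, rfl⟩
    rw [show (2 * k + 1 - 1) / 2 = k by omega, show 2 * k + 1 - 1 = 2 * k by omega,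
      show a.sum + (2 * k + 1) + z - 1 = a.sum + z + 2 * k by omega,
      show 2 * a.sum + (2 * k + 1) + 2 * z = 2 * k + 1 + 2 * (a.sum + z) by ring,
      show 2 * a.sum + 2 * (2 * k + 1) + 2 * z - 1 = 2 * (a.sum + z + 2 * k) + 1 by omega,
      show 2 * a.sum + 2 * (2 * k + 1) + 2 * z + 1 = 2 * (a.sum + z) + 4 * k + 3 by ring]
    exact numTilings_regionR_two_mul_add_one_eq x k z a
  · intro heven
    obtain ⟨k, rfl⟩ := even_iff_exists_two_mul.1 heven
    have habove : 0 < k + oddSum a := by omega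
    rw [show 2 * k / 2 = k by omega, show a.sum + 2 * k + z = a.sum + z + 2 * k by ring,
      show 2 * a.sum + 2 * k + 2 * z = 2 * k + 2 * (a.sum + z) by ring,
      show 2 * a.sum + 2 * (2 * k) + 2 * z = 2 * (a.sum + z) + 4 * k by ring]
    exact numTilings_regionR_two_mul_eq x ha habove
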